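/- For a number field $F$ and a nonzero tuple $x=(x_1,\dots,x_m)\in F^m$ let $h(x)=\sum_{v\in M_F}\frac{[F_v:\mathbb{Q}_v]}{[F:\mathbb{Q}]}\log\max_i|x_i|_v$ be the absolute logarithmic Weil height. Let $K$ be a number field. A point $x$ of projective space over $K(t)$ can be written as $x=[x_0:\cdots:x_m]$ with $x_i\in K[t]$ without common factor, uniquely up to a common scalar in $K^*$. Put $h^{\mathrm{geom}}(x)=\max_i\deg x_i$, let $h^{\mathrm{arith}}(x)$ be the height of the projective tuple of all coefficients of all the $x_i$, and put $h^{\mathrm{total}}(x)=h^{\mathrm{arith}}(x)+h^{\mathrm{geom}}(x)$. For a finite extension $L/K$ and $t\in\mathbb{P}^1(L)$, the specialization $x_t$ is obtained by evaluating the $x_i$, viewed as binary forms of degree $h^{\mathrm{geom}}(x)$, at $t$. A morphism $f:\mathbb{P}^N\to\mathbb{P}^N$ of degree $d$ over $K(t)$ is given by $N+1$ forms of degree $d$ over $K(t)$ without nontrivial common zero over $\overline{K(t)}$; it is identified with the point of projective space given by its tuple of coefficients, which defines $h^{\mathrm{total}}(f)$ and the specialization $f_t$. If $d\ge 2$, the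 canonical height of $P\in\mathbb{P}^N(K(t))$ is $\hat h_f(P)=\lim_{n\to\infty}d^{-n}h^{\mathrm{geom}}(f^n(P))$. **Corollary.** There is a computable function $C:\mathbb{N}\times\mathbb{N}\to\mathbb{N}$ such that the following holds for all integers $d\ge 2$ and $N\geq 0$. Let $K$ be a number field, let $f:\mathbb{P}^N\to\mathbb{P}^N$ be a morphism of degree $d$ defined over $K(t)$, and let $P\in\mathbb{P}^N(K(t))$ satisfy $\hat h_f(P)\neq 0$. Let $L/K$ be a finite extension and $t\in\mathbb{P}^1(L)$. If $P_t$ is preperiodic for $f_t$ (that is, $f_t^m(P_t)$ and $f_t^n(P_t)$ are defined and equal for some $m<n$), then $$h(t)\le C(d,N)\,\max\left\{\frac{\left(h^{\mathrm{total}}(P)+h^{\mathrm{total}}(f)+1\right)^4}{\hat h_f(P)^2},\; h^{\mathrm{total}}(f)+1\right\}.$$ -/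

import Mathlib

open Polynomial Filter

namespace ProjDyn

noncomputable section

/-- The absolute logarithmic Weil height `∑_v n_v log ‖x‖_v`, with `n_v = [K_v : ℚ_v] / [K : ℚ]`,
of a tuple of elements of a number field. -/
def absHeight {K : Type*} [Field K] [NumberField K] {ι : Type*} (x : ι → K) : ℝ :=
  Height.logHeight x / (Module.finrank ℚ K : ℝ)

/-! ### Points of projective space over `K(t)` -/

section FunctionField

variable {K : Type*} [Field K] {ι : Type*}

/-- `q` is a tuple of polynomials without common factor which represents the same point
of projective space over `K(t)` as the tuple `x`. -/
def IsPrimitiveRep (q : ι → K[X]) (x : ι → RatFunc K) : Prop :=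
  (∀ r : K[X], (∀ i, r ∣ q i) → IsUnit r) ∧
    ∃ c : RatFunc K, c ≠ 0 ∧ ∀ i, x i = c * algebraMap K[X] (RatFunc K) (q i)

theorem exists_isPrimitiveRep [Fintype ι] (x : ι → RatFunc K) (hx : x ≠ 0) :
    ∃ q : ι → K[X], IsPrimitiveRep q x := by
  classical
  obtain ⟨b, hb⟩ := IsLocalization.exist_integer_multiples_of_finite (nonZeroDivisors K[X]) x
  choose y hy using hb
  have hb0 : algebraMap K[X] (RatFunc K) (b : K[X]) ≠ 0 := by
    simp
  obtain ⟨i₀, hi₀⟩ : ∃ i, x i ≠ 0 := by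
    by_contra h
    push Not at h
    exact hx (funext h)
  have hy' : ∀ i, algebraMap K[X] (RatFunc K) (y i)
      = algebraMap K[X] (RatFunc K) (b : K[X]) * x i := fun i => by
    rw [hy i, Algebra.smul_def]
  have hy0 : y i₀ ≠ 0 := by
    intro h
    have h1 := hy' i₀
    rw [h, map_zero] at h1
    exact (mul_ne_zero hb0 hi₀) h1.symm
  obtain ⟨q, hq, hgcd⟩ := Finset.extract_gcd (s := Finset.univ) y ⟨i₀, Finset.mem_univ i₀⟩
  set g : K[X] := Finset.univ.gcd y with hg
  have hg0 : algebraMap K[X] (RatFunc K) g ≠ 0 := by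
    have : g ≠ 0 := by
      intro h
      apply hy0
      rw [hq i₀ (Finset.mem_univ _), h, zero_mul]
    simpa using this
  refine ⟨q, fun r hr => ?_, algebraMap K[X] (RatFunc K) g / algebraMap K[X] (RatFunc K) b,
    div_ne_zero hg0 hb0, fun i => ?_⟩
  · have : r ∣ Finset.univ.gcd q := Finset.dvd_gcd fun i _ => hr i
    rw [hgcd] at this
    exact isUnit_of_dvd_one this
  · have h1 := hy' i
    rw [hq i (Finset.mem_univ _), map_mul] at h1
    field_simp
    linear_combination -h1

variable [Fintype ι]

/-- Coordinates in `K[t]` without common factor of a point of projective space over `K(t)`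
(unique up to a common nonzero scalar in `K`). -/
def primitive (x : Projectivization (RatFunc K) (ι → RatFunc K)) : ι → K[X] :=
  (exists_isPrimitiveRep x.rep x.rep_nonzero).choose

theorem primitive_spec (x : Projectivization (RatFunc K) (ι → RatFunc K)) :
    IsPrimitiveRep (primitive x) x.rep :=
  (exists_isPrimitiveRep x.rep x.rep_nonzero).choose_spec

/-- The geometric height: the maximal degree of coprime polynomial coordinates. -/
def geomHeight (x : Projectivization (RatFunc K) (ι → RatFunc K)) : ℕ :=
  Finset.univ.sup fun i => (primitive x i).natDegree

/-- The arithmetic height: the height of the projective tuple of all coefficients of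
coprime polynomial coordinates. -/
def arithHeight [NumberField K] (x : Projectivization (RatFunc K) (ι → RatFunc K)) : ℝ :=
  absHeight fun p : ι × Fin (geomHeight x + 1) => (primitive x p.1).coeff p.2

/-- The total height. -/
def totalHeight [NumberField K] (x : Projectivization (RatFunc K) (ι → RatFunc K)) : ℝ :=
  arithHeight x + geomHeight x

/-- Coprime polynomial coordinates of `x`, viewed as binary forms of degree `geomHeight x`
and evaluated at `(s 0, s 1)`; the value of the parameter is `s 0 / s 1`. -/
def specializeVec {L : Type*} [Field L] [Algebra K L]
    (x : Projectivization (RatFunc K) (ι → RatFunc K)) (s : Fin 2 → L) : ι → L := fun i =>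
  ∑ j ∈ Finset.range (geomHeight x + 1),
    algebraMap K L ((primitive x i).coeff j) * s 0 ^ j * s 1 ^ (geomHeight x - j)

theorem specializeVec_ne_zero {L : Type*} [Field L] [Algebra K L]
    (x : Projectivization (RatFunc K) (ι → RatFunc K)) (s : Fin 2 → L) (hs : s ≠ 0) :
    specializeVec x s ≠ 0 := by
  classical
  intro h
  have hz : ∀ i, specializeVec x s i = 0 := fun i => congrFun h i
  have hdeg : ∀ i, (primitive x i).natDegree ≤ geomHeight x := fun i =>
    Finset.le_sup (f := fun i => (primitive x i).natDegree) (Finset.mem_univ i)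
  have hprim := (primitive_spec x).1
  by_cases h1 : s 1 = 0
  · have h0 : s 0 ≠ 0 := by
      intro h0
      apply hs
      funext i
      fin_cases i
      · exact h0
      · exact h1
    have hc : ∀ i, (primitive x i).coeff (geomHeight x) = 0 := by
      intro i
      have h2 := hz i
      simp only [specializeVec, h1] at h2
      rw [Finset.sum_range_succ, Finset.sum_eq_zero] at h2
      · simpa [h0] using h2
      · intro j hj
        have : geomHeight x - j ≠ 0 := by
          have := Finset.mem_range.1 hj
          omega
        simp [this]
    have hι : (Finset.univ : Finset ι).Nonempty := by
      rw [Finset.univ_nonempty_iff]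
      by_contra hne
      rw [not_nonempty_iff] at hne
      exact not_isUnit_zero (hprim 0 fun i => (hne.false i).elim)
    obtain ⟨i, -, hi⟩ := Finset.exists_mem_eq_sup Finset.univ hι
      fun i => (primitive x i).natDegree
    have hi' : (primitive x i).natDegree = geomHeight x := hi.symm
    have hi0 : primitive x i = 0 := by
      have := hc i
      rw [← hi'] at this
      simpa using this
    have hg : geomHeight x = 0 := by rw [← hi', hi0]; simp
    refine not_isUnit_zero (hprim 0 fun k => ?_)
    have hk : (primitive x k).natDegree = 0 := by
      have := hdeg k
      omega
    have hk2 := hc k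
    rw [hg] at hk2
    rw [Polynomial.eq_C_of_natDegree_eq_zero hk, hk2]
    simp
  · have hroot : ∀ i, aeval (s 0 / s 1) (primitive x i) = 0 := by
      intro i
      rw [aeval_eq_sum_range' (Nat.lt_succ_of_le (hdeg i))]
      have h2 := hz i
      simp only [specializeVec] at h2
      have h3 : s 1 ^ geomHeight x * ∑ j ∈ Finset.range (geomHeight x + 1),
          (primitive x i).coeff j • (s 0 / s 1) ^ j = 0 := by
        rw [← h2, Finset.mul_sum]
        refine Finset.sum_congr rfl fun j hj => ?_
        have hj' : j ≤ geomHeight x := Nat.lt_succ_iff.1 (Finset.mem_range.1 hj)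
        rw [Algebra.smul_def, div_pow, ← Nat.sub_add_cancel hj', pow_add,
          Nat.sub_add_cancel hj']
        field_simp
      exact (mul_eq_zero.1 h3).resolve_left (pow_ne_zero _ h1)
    have hg : IsUnit (Finset.univ.gcd (primitive x)) :=
      hprim _ fun i => Finset.gcd_dvd (Finset.mem_univ i)
    have hspan : Ideal.span (Set.range (primitive x)) = ⊤ := by
      obtain ⟨r, hr⟩ := IsPrincipalIdealRing.principal (Ideal.span (Set.range (primitive x)))
      have hr' : Ideal.span (Set.range (primitive x)) = Ideal.span {r} := hr
      rw [hr', Ideal.span_singleton_eq_top]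
      refine hprim r fun i => ?_
      rw [← Ideal.mem_span_singleton, ← hr']
      exact Ideal.subset_span ⟨i, rfl⟩
    have hker : Ideal.span (Set.range (primitive x))
        ≤ RingHom.ker (aeval (R := K) (s 0 / s 1)) := by
      rw [Ideal.span_le]
      rintro _ ⟨i, rfl⟩
      exact hroot i
    rw [hspan] at hker
    have : (1 : K[X]) ∈ RingHom.ker (aeval (R := K) (s 0 / s 1)) := hker trivial
    rw [RingHom.mem_ker, map_one] at this
    exact one_ne_zero this

/-- The specialization `x_t` at a point `t` of the projective line. -/
def specialize {L : Type*} [Field L] [Algebra K L]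
    (x : Projectivization (RatFunc K) (ι → RatFunc K)) (t : Projectivization L (Fin 2 → L)) :
    Projectivization L (ι → L) :=
  Projectivization.mk L (specializeVec x t.rep) (specializeVec_ne_zero x t.rep t.rep_nonzero)

end FunctionField

/-! ### Maps given by forms -/

/-- Exponents of the monomials of degree `d` in `N + 1` variables. -/
abbrev Mon (N d : ℕ) : Type :=
  {m : Fin (N + 1) →₀ ℕ // m ∈ (Finset.univ : Finset (Fin (N + 1))).finsuppAntidiag d}

/-- The `N + 1` forms of degree `d` with a given tuple of coefficients. -/
def formsOf {L : Type*} [Field L] {N d : ℕ} (c : Fin (N + 1) × Mon N d → L) :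
    Fin (N + 1) → MvPolynomial (Fin (N + 1)) L := fun i =>
  ∑ m : Mon N d, MvPolynomial.monomial m.1 (c (i, m))

/-- Evaluation of a tuple of polynomials. -/
def evalForms {L : Type*} [Field L] {N : ℕ} (G : Fin (N + 1) → MvPolynomial (Fin (N + 1)) L)
    (v : Fin (N + 1) → L) : Fin (N + 1) → L := fun i => MvPolynomial.eval v (G i)

/-- `x` is preperiodic under the map given by the forms `G`: two different iterates of `x`
agree. If the forms have a common zero, so that the map is not everywhere defined, the iterates
in question are required to be defined. -/
def IsPreperiodic {L : Type*} [Field L] {N : ℕ}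
    (G : Fin (N + 1) → MvPolynomial (Fin (N + 1)) L)
    (x : Projectivization L (Fin (N + 1) → L)) : Prop :=
  ∃ m n : ℕ, m < n ∧ ∃ (hm : (evalForms G)^[m] x.rep ≠ 0) (hn : (evalForms G)^[n] x.rep ≠ 0),
    Projectivization.mk L _ hm = Projectivization.mk L _ hn

/-- A presentation of a morphism from projective `N`-space over `k` to itself, of degree `d`:
forms of degree `d` without common zero other than `0` over an algebraic closure. -/
structure ProjEndo (k : Type*) [Field k] (N d : ℕ) where
  /-- The forms that define the morphism. -/
  form : Fin (N + 1) → MvPolynomial (Fin (N + 1)) k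
  isHomogeneous : ∀ i, (form i).IsHomogeneous d
  eq_zero_of_aeval : ∀ x : Fin (N + 1) → AlgebraicClosure k,
    (∀ i, MvPolynomial.aeval x (form i) = 0) → x = 0

namespace ProjEndo

variable {k : Type*} [Field k] {N d : ℕ}

theorem evalForms_ne_zero (f : ProjEndo k N d) {v : Fin (N + 1) → k} (hv : v ≠ 0) :
    evalForms f.form v ≠ 0 := by
  intro h
  apply hv
  have h2 := f.eq_zero_of_aeval (fun i => algebraMap k _ (v i)) fun i => by
    have h1 : MvPolynomial.eval v (f.form i) = 0 := congrFun h i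
    have h3 := MvPolynomial.aeval_algebraMap_apply (AlgebraicClosure k) v (f.form i)
    rw [MvPolynomial.aeval_eq_eval] at h3
    rw [h1, map_zero] at h3
    exact h3
  funext i
  simpa using congrFun h2 i

/-- The self-map of the set of `k`-points of projective space. -/
def map (f : ProjEndo k N d) (x : Projectivization k (Fin (N + 1) → k)) :
    Projectivization k (Fin (N + 1) → k) :=
  Projectivization.mk k (evalForms f.form x.rep) (f.evalForms_ne_zero x.rep_nonzero)

/-- The tuple of coefficients of the forms. -/
def coeffs (f : ProjEndo k N d) : Fin (N + 1) × Mon N d → k := fun p =>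
  (f.form p.1).coeff p.2.1

theorem coeffs_ne_zero (f : ProjEndo k N d) : f.coeffs ≠ 0 := by
  intro h
  have hform : ∀ i, f.form i = 0 := by
    intro i
    ext m
    rw [MvPolynomial.coeff_zero]
    by_contra hm
    have hdeg := f.isHomogeneous i hm
    have hmem : m ∈ (Finset.univ : Finset (Fin (N + 1))).finsuppAntidiag d := by
      rw [Finset.mem_finsuppAntidiag]
      refine ⟨?_, Finset.subset_univ _⟩
      rw [← hdeg, Finsupp.weight_apply, Finsupp.sum_fintype]
      · simp
      · simp
    exact hm (congrFun h (i, ⟨m, hmem⟩))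
  have h1 := f.eq_zero_of_aeval (fun _ => 1) fun i => by rw [hform i, map_zero]
  exact one_ne_zero (congrFun h1 0)

/-- The tuple of coefficients as a point of projective space. -/
def coeffPoint (f : ProjEndo k N d) : Projectivization k (Fin (N + 1) × Mon N d → k) :=
  Projectivization.mk k f.coeffs f.coeffs_ne_zero

variable {K : Type*} [Field K]

/-- The forms that define the specialization `f_t`: the coefficients of `f`, written as
polynomials without common factor, are evaluated at `t`. -/
def specialize (f : ProjEndo (RatFunc K) N d) {L : Type*} [Field L] [Algebra K L]
    (t : Projectivization L (Fin 2 → L)) : Fin (N + 1) → MvPolynomial (Fin (N + 1)) L :=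
  formsOf (ProjDyn.specialize f.coeffPoint t).rep

/-- The total height of `f`: the total height of its tuple of coefficients. -/
def totalHeight [NumberField K] (f : ProjEndo (RatFunc K) N d) : ℝ :=
  ProjDyn.totalHeight f.coeffPoint

/-- The canonical height on the generic fibre, the limit of `geomHeight (f^n(P)) / d^n`. -/
def canonicalHeight (f : ProjEndo (RatFunc K) N d)
    (P : Projectivization (RatFunc K) (Fin (N + 1) → RatFunc K)) : ℝ :=
  limUnder atTop fun n : ℕ => (geomHeight (f.map^[n] P) : ℝ) / (d : ℝ) ^ n

end ProjEndo

end

end ProjDyn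

/-! The preperiodic point is squeezed between two height estimates. The point at infinity has height
zero, so let `t = a` be finite, and put `x = h(a)`, `T = h^total(f) + 1`, `H = h^total(P) +
h^total(f) + 1` and `η = ĥ_f(P)`. Let `Q` denote a bound that depends on `d` and `N` only.

The role of the resultant of `f` is played by a minor `S ∈ K[t]` of a Macaulay matrix: if `E` is
large in terms of `d` and `N`, the products of the forms of `f` with monomials span all forms of
degree `E`, and a square subsystem with nonzero determinant `S` is selected. Cramer's rule then
writes `S * v_i ^ E` as a combination of the coordinates of `f(v)`, and this identity survives
specialization. The size of the matrix is explicit because an explicit power of each variable lies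
in the ideal of the forms (`X_pow_mem_span_of_no_common_zero`).

If `S(a) = 0`, then `a` is a root of a nonzero polynomial of controlled degree and height, so `x` is
at most a constant times `T`. Otherwise `d * h(v) ≤ h(f_a(v)) + B` for all `v`, with `B = Q ^ 2 + Q
* T * (1 + x)`. A point of height greater than `B` has strictly increasing heights along its orbit,
so every point of the preperiodic orbit has height at most `B`.

In the other direction, let `D_k` be the degree of `f^k(P)`. It differs from `d ^ k * η` by at most
`2 * Q * T`. The lower bound for the height of a specialization gives `D_k * x ≤ h(f^k(P)_a) + 2 *
D_k + 4 * D_k ^ 2 + 2 * D_k * p_k`, where the arithmetic height `p_k` of `f^k(P)` is at most `Q * d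
^ k * H`. Once `d ^ k * η ≥ 4 * Q * T`, the degree `D_k` is at least `2 * Q * T`, and the term `Q *
T * x` in `B` is absorbed on the left. The least such `k` gives the bound by `H ^ 4 / η ^ 2`.

The carrying lemmas are `exists_det_macaulayMinor_ne_zero`, `mul_absHeight_le_formVal`,
`natDegree_mul_absHeight_le`, `polyHeight_le_of_mul_eq` (Gelfond), `abs_geomHeight_sub_le`,
`polyHeight_primitive_iterate_le` and `absHeight_iterate_le_of_preperiodic`. -/

namespace MvPolynomial

/-! ### Homogeneous ideals and an explicit projective Nullstellensatz -/

section Homogeneous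

variable {σ ι R : Type*} [CommRing R]

theorem homogeneousComponent_mul_of_isHomogeneous {G : MvPolynomial σ R} {d : ℕ}
    (hG : G.IsHomogeneous d) (a : MvPolynomial σ R) (s : ℕ) :
    homogeneousComponent s (a * G) = if d ≤ s then homogeneousComponent (s - d) a * G else 0 := by
  classical
  conv_lhs => rw [← sum_homogeneousComponent a, Finset.sum_mul, map_sum]
  have h1 : ∀ i, homogeneousComponent s (homogeneousComponent i a * G)
      = if i + d = s then homogeneousComponent i a * G else 0 := fun i => by
    have hm : homogeneousComponent i a * G ∈ homogeneousSubmodule σ R (i + d) :=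
      (homogeneousComponent_isHomogeneous i a).mul hG
    rw [homogeneousComponent_of_mem hm]
    simp only [eq_comm]
  simp only [h1]
  split_ifs with hds
  · rw [Finset.sum_eq_single (s - d)]
    · rw [if_pos (by omega)]
    · intro b _ hb
      rw [if_neg (by omega)]
    · intro hb
      rw [if_pos (by omega)]
      rw [homogeneousComponent_eq_zero, zero_mul]
      have : a.totalDegree + 1 ≤ s - d := by
        simpa only [Finset.mem_range, not_lt] using hb
      omega
  · refine Finset.sum_eq_zero fun i _ => if_neg (by omega)

variable [Fintype ι]

/-- A homogeneous component of an element of the ideal generated by forms of degree `d` is a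
combination of these forms with homogeneous coefficients. -/
theorem exists_homogeneousComponent_eq_sum {F : ι → MvPolynomial σ R} {d : ℕ}
    (hF : ∀ i, (F i).IsHomogeneous d) {p : MvPolynomial σ R}
    (hp : p ∈ Ideal.span (Set.range F)) {s : ℕ} (hs : d ≤ s) :
    ∃ A : ι → MvPolynomial σ R, (∀ i, (A i).IsHomogeneous (s - d)) ∧
      homogeneousComponent s p = ∑ i, A i * F i := by
  obtain ⟨c, rfl⟩ := (Ideal.mem_span_range_iff_exists_fun).1 hp
  refine ⟨fun i => homogeneousComponent (s - d) (c i),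
    fun i => homogeneousComponent_isHomogeneous _ _, ?_⟩
  rw [map_sum]
  refine Finset.sum_congr rfl fun i _ => ?_
  rw [homogeneousComponent_mul_of_isHomogeneous (hF i), if_pos hs]

theorem homogeneousComponent_mem_span {F : ι → MvPolynomial σ R} {d : ℕ}
    (hF : ∀ i, (F i).IsHomogeneous d) {p : MvPolynomial σ R}
    (hp : p ∈ Ideal.span (Set.range F)) (s : ℕ) :
    homogeneousComponent s p ∈ Ideal.span (Set.range F) := by
  obtain ⟨c, rfl⟩ := (Ideal.mem_span_range_iff_exists_fun).1 hp
  rw [map_sum]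
  refine Ideal.sum_mem _ fun i _ => ?_
  rw [homogeneousComponent_mul_of_isHomogeneous (hF i)]
  split_ifs
  · exact Ideal.mul_mem_left _ _ (Ideal.subset_span ⟨i, rfl⟩)
  · exact zero_mem _

end Homogeneous

section Finite

variable {σ k : Type*} [Field k] [Fintype σ] 

/-- A monomial that is divisible by a high power of a variable lies in an ideal that contains
these powers. -/
theorem monomial_mem_of_X_pow_mem {I : Ideal (MvPolynomial σ k)} {n : ℕ}
    (hI : ∀ i, (X i : MvPolynomial σ k) ^ n ∈ I) {m : σ →₀ ℕ}
    (hm : Fintype.card σ * n ≤ m.degree) (hc : 0 < m.degree) (c : k) : monomial m c ∈ I := by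
  classical
  obtain ⟨i, hi⟩ : ∃ i, n ≤ m i := by
    by_contra! h
    rw [Finsupp.degree_eq_sum] at hm hc
    rcases isEmpty_or_nonempty σ with hσ | hσ
    · simp at hc
    · have : ∑ i, m i < ∑ _i : σ, n :=
        Finset.sum_lt_sum_of_nonempty Finset.univ_nonempty fun i _ => h i
      simp at this
      omega
  have : monomial m c = monomial (m - Finsupp.single i n) c * X i ^ n := by
    rw [X_pow_eq_monomial, monomial_mul, mul_one, tsub_add_cancel_of_le]
    simpa using hi
  rw [this]
  exact Ideal.mul_mem_left _ _ (hI i)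

variable {F : σ → MvPolynomial σ k} {d : ℕ}

/-- Graded Nakayama: a form of large degree lies in the ideal of the `F i`, with homogeneous
cofactors of smaller degree, so induction on the degree reduces everything to the finitely many
monomials of degree below `B`. -/
theorem finite_adjoin_of_X_pow_mem (hd : 0 < d)
    (hF : ∀ i, (F i).IsHomogeneous d) {n : ℕ}
    (hn : ∀ i, (X i : MvPolynomial σ k) ^ n ∈ Ideal.span (Set.range F)) :
    Module.Finite (Algebra.adjoin k (Set.range F)) (MvPolynomial σ k) := by
  classical
  set A := Algebra.adjoin k (Set.range F)
  set B := Fintype.card σ * n + d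
  set S : Set (σ →₀ ℕ) := {m | m.degree < B}
  have hS : S.Finite := by
    have : S ⊆ ((Finset.range B).biUnion fun s => Finset.univ.finsuppAntidiag s : Finset (σ →₀ ℕ)) := by
      intro m hm
      simp only [Finset.coe_biUnion, Set.mem_iUnion]
      exact ⟨m.degree, Finset.mem_coe.2 (Finset.mem_range.2 hm), by simp [Finset.mem_finsuppAntidiag, Finsupp.degree_eq_sum]⟩
    exact (Finset.finite_toSet _).subset this
  set T : Submodule A (MvPolynomial σ k) :=
    Submodule.span A ((fun m => (monomial m 1 : MvPolynomial σ k)) '' S) with hT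
  have hC : ∀ (c : k) (p : MvPolynomial σ k), p ∈ T → C c * p ∈ T := by
    intro c p hp
    have := T.smul_mem (algebraMap k A c) hp
    rwa [Algebra.smul_def] at this
  have key : ∀ s, ∀ p : MvPolynomial σ k, p.IsHomogeneous s → p ∈ T := by
    intro s
    induction s using Nat.strong_induction_on with
    | _ s ih =>
      intro p hp
      have hdeg : ∀ m ∈ p.support, m.degree = s := fun m hm => by
        have := hp (mem_support_iff.1 hm)
        rw [Finsupp.degree_eq_weight_one]
        exact this
      by_cases hs : s < B
      · rw [p.as_sum]
        refine T.sum_mem fun m hm => ?_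
        have : monomial m (coeff m p) = C (coeff m p) * monomial m 1 := by
          rw [C_mul_monomial, mul_one]
        rw [this]
        refine hC _ _ (Submodule.subset_span ⟨m, ?_, rfl⟩)
        change m.degree < B
        rw [hdeg m hm]; exact hs
      · have hpI : p ∈ Ideal.span (Set.range F) := by
          rw [p.as_sum]
          refine Ideal.sum_mem _ fun m hm => ?_
          have := hdeg m hm
          exact monomial_mem_of_X_pow_mem hn (by omega) (by omega) _
        obtain ⟨a, ha, hsum⟩ := exists_homogeneousComponent_eq_sum hF hpI (s := s) (by omega)
        rw [homogeneousComponent_of_mem hp, if_pos rfl] at hsum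
        rw [hsum]
        refine T.sum_mem fun i _ => ?_
        have h1 := ih (s - d) (by omega) (a i) (ha i)
        have h2 := T.smul_mem (⟨F i, Algebra.subset_adjoin ⟨i, rfl⟩⟩ : A) h1
        rw [mul_comm]
        exact h2
  refine ⟨⟨(hS.image (fun m => (monomial m 1 : MvPolynomial σ k))).toFinset, ?_⟩⟩
  rw [Set.Finite.coe_toFinset, ← hT, eq_top_iff]
  intro p _
  rw [← sum_homogeneousComponent p]
  exact T.sum_mem fun i _ => key i _ (homogeneousComponent_isHomogeneous i p)

/-- The polynomial ring is algebraic over `k[F]`, and the number of the `F i` equals its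
transcendence degree, so the `F i` form a transcendence basis. -/
theorem algebraicIndependent_of_X_pow_mem (hd : 0 < d)
    (hF : ∀ i, (F i).IsHomogeneous d) {n : ℕ}
    (hn : ∀ i, (X i : MvPolynomial σ k) ^ n ∈ Ideal.span (Set.range F)) :
    AlgebraicIndependent k F := by
  have := finite_adjoin_of_X_pow_mem hd hF hn
  have : Algebra.IsIntegral (Algebra.adjoin k (Set.range F)) (MvPolynomial σ k) :=
    Algebra.IsIntegral.of_finite _ _
  refine (Algebra.IsAlgebraic.isTranscendenceBasis_of_lift_le_trdeg_of_finite k F ?_).1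
  rw [MvPolynomial.trdeg_of_isDomain]
  simp

/-- A nontrivial polynomial relation of bounded degree between a linear form and forms, which
exists for reasons of dimension. -/
theorem exists_relation (hF : ∀ i, (F i).IsHomogeneous d) (x : σ) {M : ℕ}
    (hM : (Fintype.card σ * d + 1) ^ Fintype.card σ ≤ M) :
    ∃ a : Fin (M + 1) → MvPolynomial σ k, a ≠ 0 ∧
      ∑ j, aeval F (a j) * X x ^ (j : ℕ) = 0 := by
  classical
  -- With `s` variables there are `n ^ (s + 1)` unknown coefficients. The resulting polynomial has
  -- degree at most `s * d * (n - 1) + M < B`, which gives at most `B ^ s = (s * d + 1) ^ s * n ^ s`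
  -- linear conditions; `hM` makes this smaller.
  set n := M + 1
  set B := (Fintype.card σ * d + 1) * n
  let exp {b : ℕ} (α : σ → Fin b) : σ →₀ ℕ := Finsupp.equivFunOnFinite.symm fun i => (α i : ℕ)
  have hexp : ∀ {b : ℕ} (α β : σ → Fin b), exp α = exp β → α = β := by
    intro b α β h
    funext i
    exact Fin.ext (DFunLike.congr_fun h i)
  let poly : (Fin n × (σ → Fin n) → k) →ₗ[k] (Fin n → MvPolynomial σ k) :=
    LinearMap.pi fun j => ∑ α : σ → Fin n,
      (monomial (exp α)).comp (LinearMap.proj (j, α))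
  have hpoly : ∀ c j, poly c j = ∑ α : σ → Fin n, monomial (exp α) (c (j, α)) := by
    intro c j
    simp [poly]
  let val : (Fin n → MvPolynomial σ k) →ₗ[k] MvPolynomial σ k :=
    ∑ j : Fin n, (LinearMap.mulRight k (X x ^ (j : ℕ) : MvPolynomial σ k)).comp
      ((aeval F).toLinearMap.comp (LinearMap.proj j))
  have hval : ∀ a, val a = ∑ j, aeval F (a j) * X x ^ (j : ℕ) := by
    intro a
    simp [val]
  let co : MvPolynomial σ k →ₗ[k] ((σ → Fin B) → k) :=
    LinearMap.pi fun β => lcoeff k (exp β)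
  have hcard : Module.finrank k ((σ → Fin B) → k) < Module.finrank k (Fin n × (σ → Fin n) → k) := by
    simp only [Module.finrank_fintype_fun_eq_card, Fintype.card_prod, Fintype.card_fun,
      Fintype.card_fin, B, mul_pow]
    have : 0 < n ^ Fintype.card σ := by positivity
    exact Nat.mul_lt_mul_of_pos_right (Nat.lt_succ_of_le hM) this
  have hker := LinearMap.ker_ne_bot_of_finrank_lt (f := co ∘ₗ val ∘ₗ poly) hcard
  obtain ⟨c, hc, hc0⟩ := (Submodule.ne_bot_iff _).1 hker
  refine ⟨poly c, ?_, ?_⟩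
  · intro h
    apply hc0
    funext ⟨j, α⟩
    have h1 := congrArg (coeff (exp α)) (congrFun h j)
    rw [hpoly, coeff_sum, Finset.sum_eq_single α] at h1
    · simpa using h1
    · intro β _ hβ
      rw [coeff_monomial, if_neg]
      intro h; exact hβ (hexp _ _ h)
    · simp
  · rw [← hval]
    have h0 : co (val (poly c)) = 0 := hc
    have htd : (val (poly c)).totalDegree < B := by
      rw [hval]
      refine lt_of_le_of_lt (totalDegree_finsetSum_le (d := d * (Fintype.card σ * (n - 1)) + M) ?_) ?_
      · intro j _
        refine (totalDegree_mul _ _).trans (add_le_add ?_ ?_)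
        · rw [hpoly, map_sum]
          refine totalDegree_finsetSum_le fun α _ => ?_
          rw [aeval_monomial]
          refine (totalDegree_mul _ _).trans ?_
          rw [← C_eq_algebraMap, totalDegree_C, zero_add, Finsupp.prod_fintype _ _ (by simp)]
          refine (totalDegree_finsetProd _ _).trans ?_
          have : ∑ i : σ, (F i ^ (exp α i)).totalDegree ≤ ∑ _i : σ, (n - 1) * d := by
            refine Finset.sum_le_sum fun i _ => ?_
            refine (totalDegree_pow _ _).trans ?_
            refine Nat.mul_le_mul ?_ (hF i).totalDegree_le
            have := (α i).2
            change ((α i : ℕ)) ≤ n - 1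
            omega
          refine this.trans (le_of_eq ?_)
          simp
          ring
        · rw [totalDegree_X_pow]
          omega
      · simp only [B]
        have hM1 : n - 1 = M := rfl
        have hM2 : n = M + 1 := rfl
        rw [hM1, hM2]
        nlinarith [Nat.zero_le (Fintype.card σ * d)]
    ext m
    rw [coeff_zero]
    by_cases hm : m ∈ (val (poly c)).support
    · have hb : ∀ i, m i < B := fun i => by
        have h1 := le_totalDegree hm
        have h2 : m i ≤ m.sum fun _ e => e := by
          rw [Finsupp.sum_fintype _ _ (by simp)]
          exact Finset.single_le_sum (f := fun i => m i) (fun _ _ => Nat.zero_le _) (Finset.mem_univ i)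
        omega
      have h3 := congrFun h0 fun i => ⟨m i, hb i⟩
      have h4 : exp (fun i => (⟨m i, hb i⟩ : Fin B)) = m := by
        ext i; rfl
      simpa [co, h4] using h3
    · exact notMem_support_iff.1 hm

/-- Replaces an unknown exponent by an explicit one. The variable is integral over `A = k[F]`, its
minimal polynomial has degree at most `M` by the relation found by counting, and modulo `I` the
coefficients in `A` become constants. Homogeneity then leaves only the leading power. -/
theorem X_pow_mem_span_of_X_pow_mem (hd : 0 < d)
    (hF : ∀ i, (F i).IsHomogeneous d) {n : ℕ}
    (hn : ∀ i, (X i : MvPolynomial σ k) ^ n ∈ Ideal.span (Set.range F)) {M : ℕ}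
    (hM : (Fintype.card σ * d + 1) ^ Fintype.card σ ≤ M) (x : σ) :
    (X x : MvPolynomial σ k) ^ M ∈ Ideal.span (Set.range F) := by
  classical
  have hind := algebraicIndependent_of_X_pow_mem hd hF hn
  have hfin := finite_adjoin_of_X_pow_mem hd hF hn
  set A := Algebra.adjoin k (Set.range F) with hA
  set I := Ideal.span (Set.range F) with hI
  have hint : Algebra.IsIntegral A (MvPolynomial σ k) := Algebra.IsIntegral.of_finite _ _
  -- `A` is a polynomial ring, hence integrally closed, so the monic minimal polynomial divides
  -- every relation over `A`, monic or not.
  have : UniqueFactorizationMonoid A :=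
    MulEquiv.uniqueFactorizationMonoid hind.aevalEquiv.toMulEquiv inferInstance
  obtain ⟨a, ha0, ha⟩ := exists_relation hF x hM
  have hx : IsIntegral A (X x : MvPolynomial σ k) := hint.isIntegral _
  have hdeg : (minpoly A (X x : MvPolynomial σ k)).natDegree ≤ M := by
    let p : A[X] := ∑ j : Fin (M + 1), Polynomial.monomial (j : ℕ) (hind.aevalEquiv (a j))
    have hp0 : p ≠ 0 := by
      intro h
      apply ha0
      funext j
      have h1 := congrArg (fun q => Polynomial.coeff q (j : ℕ)) h
      simp only [p, Polynomial.finsetSum_coeff, Polynomial.coeff_monomial, Polynomial.coeff_zero,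
        Fin.val_inj] at h1
      simpa using h1
    have hpx : Polynomial.aeval (X x : MvPolynomial σ k) p = 0 := by
      rw [← ha, map_sum]
      refine Finset.sum_congr rfl fun j _ => ?_
      rw [Polynomial.aeval_monomial]
      rw [hind.algebraMap_aevalEquiv]
    have hdvd := minpoly.isIntegrallyClosed_dvd hx hpx
    refine (Polynomial.natDegree_le_of_dvd hdvd hp0).trans ?_
    refine Polynomial.natDegree_sum_le_of_forall_le _ _ fun j _ => ?_
    exact (Polynomial.natDegree_monomial_le _).trans (by omega)
  set f := minpoly A (X x : MvPolynomial σ k) with hf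
  set D := f.natDegree
  -- The generators of `A` lie in `I`, so an element of `A` is congruent to a constant.
  have hconst : ∀ b : A, ∃ c : k, (b : MvPolynomial σ k) - C c ∈ I := by
    rintro ⟨b, hb⟩
    refine Algebra.adjoin_induction (p := fun b _ => ∃ c : k, b - C c ∈ I) ?_ ?_ ?_ ?_ hb
    · intro b hb
      exact ⟨0, by simpa using Ideal.subset_span hb⟩
    · intro r
      exact ⟨r, by simp⟩
    · rintro x y - - ⟨c, hc⟩ ⟨c', hc'⟩
      refine ⟨c + c', ?_⟩
      have := I.add_mem hc hc'
      rw [map_add]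
      convert this using 1
      ring
    · rintro x y - - ⟨c, hc⟩ ⟨c', hc'⟩
      refine ⟨c * c', ?_⟩
      have := I.add_mem (I.mul_mem_right y hc) (I.mul_mem_left (C c) hc')
      rw [map_mul]
      convert this using 1
      ring
  choose c hc using hconst
  have hroot : (X x : MvPolynomial σ k) ^ D
      + ∑ j ∈ Finset.range D, (f.coeff j : MvPolynomial σ k) * X x ^ j = 0 := by
    have h1 : Polynomial.aeval (X x : MvPolynomial σ k) f = 0 := minpoly.aeval A _
    rw [Polynomial.aeval_eq_sum_range, Finset.sum_range_succ] at h1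
    have h2 : f.coeff f.natDegree = 1 := (minpoly.monic hx).coeff_natDegree
    rw [h2, one_smul, add_comm] at h1
    exact h1
  have hmem : (X x : MvPolynomial σ k) ^ D
      + ∑ j ∈ Finset.range D, C (c (f.coeff j)) * X x ^ j ∈ I := by
    have h1 : ∑ j ∈ Finset.range D, ((f.coeff j : MvPolynomial σ k) - C (c (f.coeff j))) * X x ^ j ∈ I :=
      Ideal.sum_mem _ fun j _ => I.mul_mem_right _ (hc _)
    rw [← neg_mem_iff] at h1
    convert h1 using 1
    simp only [sub_mul, Finset.sum_sub_distrib]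
    linear_combination hroot
  -- The terms `c_j * X ^ j` with `j < D` have no component of degree `D`, so this component is `X ^
  -- D`.
  have hcomp := homogeneousComponent_mem_span hF hmem D
  have hX : ∀ (b : k) (j : ℕ), homogeneousComponent D (C b * X x ^ j : MvPolynomial σ k)
      = if D = j then C b * X x ^ j else 0 := by
    intro b j
    have : (C b * X x ^ j : MvPolynomial σ k) ∈ homogeneousSubmodule σ k j :=
      (isHomogeneous_X_pow x j).C_mul b
    rw [homogeneousComponent_of_mem this]
  rw [map_add, map_sum, Finset.sum_eq_zero, add_zero] at hcomp
  · have h1 := hX 1 D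
    rw [if_pos rfl, C_1, one_mul] at h1
    rw [h1] at hcomp
    rw [← Nat.sub_add_cancel hdeg, pow_add]
    exact I.mul_mem_left _ hcomp
  · intro j hj
    rw [hX, if_neg]
    have := Finset.mem_range.1 hj
    omega

/-- An explicit exponent in the projective Nullstellensatz for as many forms as variables. -/
theorem X_pow_mem_span_of_no_common_zero (hd : 0 < d)
    (hF : ∀ i, (F i).IsHomogeneous d)
    (h0 : ∀ x : σ → AlgebraicClosure k, (∀ i, aeval x (F i) = 0) → x = 0) {M : ℕ}
    (hM : (Fintype.card σ * d + 1) ^ Fintype.card σ ≤ M) (x : σ) :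
    (X x : MvPolynomial σ k) ^ M ∈ Ideal.span (Set.range F) := by
  have hrad : ∀ i, (X i : MvPolynomial σ k) ∈ (Ideal.span (Set.range F)).radical := by
    intro i
    rw [← vanishingIdeal_zeroLocus_eq_radical (K := AlgebraicClosure k), mem_vanishingIdeal_iff]
    intro y hy
    have : y = 0 := h0 y fun j => hy _ (Ideal.subset_span ⟨j, rfl⟩)
    simp [this]
  choose n hn using hrad
  refine X_pow_mem_span_of_X_pow_mem hd hF (n := ∑ i, n i) (fun i => ?_) hM x
  have : n i ≤ ∑ i, n i := Finset.single_le_sum (f := n) (fun _ _ => Nat.zero_le _) (Finset.mem_univ i)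
  rw [← Nat.sub_add_cancel this, pow_add]
  exact Ideal.mul_mem_left _ _ (hn i)

end Finite

end MvPolynomial

namespace Height

open AdmissibleAbsValues Function

/-! ### Comparison of heights place by place -/

section Comparison

variable {K : Type*} [Field K] [AdmissibleAbsValues K] {ι ι' : Type*} [Finite ι] [Finite ι']

/-- Zero coordinates do not affect the maximum, and a nonzero element has absolute value one at
almost all places. -/
theorem hasFiniteMulSupport_iSup {x : ι → K} (hx : x ≠ 0) :
    (fun v : nonarchAbsVal (K := K) ↦ ⨆ i, v.val (x i)).HasFiniteMulSupport := by
  have : Nonempty {j // x j ≠ 0} := nonempty_subtype.mpr <| ne_iff.mp hx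
  suffices (fun v : nonarchAbsVal (K := K) ↦
      ⨆ i : {j // x j ≠ 0}, v.val (x i)).HasFiniteMulSupport by
    convert! this with v
    obtain ⟨i, hi⟩ : ∃ j, x j ≠ 0 := Function.ne_iff.mp hx
    have : Nonempty ι := .intro i
    refine le_antisymm (ciSup_le fun j ↦ ?_) (ciSup_le fun ⟨j, hj⟩ ↦ Finite.le_ciSup_of_le j le_rfl)
    rcases eq_or_ne (x j) 0 with h | h
    · rw [h, v.val.map_zero]
      exact Real.iSup_nonneg' ⟨⟨i, hi⟩, v.val.nonneg ..⟩
    · exact Finite.le_ciSup_of_le ⟨j, h⟩ le_rfl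
  exact Function.HasFiniteMulSupport.iSup fun i => hasFiniteMulSupport i.2

/-- Comparison of heights from a comparison at every place. -/
theorem mulHeight_le_of_forall_le {y : ι' → K} {z : ι → K} {c : ℝ} (hc : 1 ≤ c)
    (h0 : z = 0 → y = 0)
    (harch : ∀ v ∈ archAbsVal (K := K), ∀ j, v (y j) ≤ c * ⨆ i, v (z i))
    (hna : ∀ v ∈ nonarchAbsVal (K := K), ∀ j, v (y j) ≤ ⨆ i, v (z i)) :
    mulHeight y ≤ c ^ totalWeight K * mulHeight z := by
  rcases eq_or_ne y 0 with rfl | hy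
  · rw [mulHeight_zero]
    exact one_le_mul_of_one_le_of_one_le (one_le_pow₀ hc) (one_le_mulHeight z)
  have hz : z ≠ 0 := fun h => hy (h0 h)
  have : Nonempty ι' := (ne_iff.mp hy).nonempty
  have hc0 : 0 ≤ c := zero_le_one.trans hc
  rw [mulHeight_eq hy, mulHeight_eq hz, ← mul_assoc]
  gcongr
  · exact finprod_nonneg fun v ↦ Real.iSup_nonneg_of_nonnegHomClass v.val _
  · exact mul_nonneg (pow_nonneg hc0 _)
      (Multiset.prod_map_nonneg fun v _ ↦ Real.iSup_nonneg_of_nonnegHomClass v _)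
  · rw [totalWeight, ← Multiset.prod_replicate, ← Multiset.map_const', ← Multiset.prod_map_mul]
    exact Multiset.prod_map_le_prod_map₀ _ _
      (fun v _ ↦ Real.iSup_nonneg_of_nonnegHomClass v _) fun v hv ↦ ciSup_le fun j => harch v hv j
  · exact finprod_le_finprod (hasFiniteMulSupport_iSup hy)
      (fun v ↦ Real.iSup_nonneg_of_nonnegHomClass v.val _)
      (hasFiniteMulSupport_iSup hz) fun v ↦ ciSup_le fun j => hna v.1 v.2 j

end Comparison

end Height

namespace ProjDyn

open Height AdmissibleAbsValues

/-- Cramer's rule without division, so that it applies over `K[X]` as well as over fields. -/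
theorem det_mul_eq_sum_adjugate {R ρ : Type*} [CommRing R] [Fintype ρ] [DecidableEq ρ]
    (B : Matrix ρ ρ R) (u w : ρ → R) (h : ∀ c, ∑ r, u r * B r c = w c) (k : ρ) :
    B.det * u k = ∑ c, w c * B.adjugate c k := by
  have h1 : Matrix.vecMul w B.adjugate = B.det • u := by
    have h2 : w = Matrix.vecMul u B := funext fun c => (h c).symm
    rw [h2, Matrix.vecMul_vecMul, Matrix.mul_adjugate, Matrix.vecMul_smul, Matrix.vecMul_one]
  exact (congrFun h1 k).symm

/-! ### Absolute heights of sums, products, determinants and polynomial values -/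

section AbsHeight

variable {K : Type*} [Field K] [NumberField K] {ι ι' κ τ : Type*}

theorem finrank_pos_real : (0 : ℝ) < Module.finrank ℚ K := by
  exact_mod_cast Module.finrank_pos

variable [Finite ι] [Finite ι']

theorem absHeight_nonneg (x : ι → K) : 0 ≤ absHeight x :=
  div_nonneg (logHeight_nonneg x) (Nat.cast_nonneg _)

omit [Finite ι] in
theorem absHeight_zero : absHeight (0 : ι → K) = 0 := by
  simp [absHeight]

theorem absHeight_smul (x : ι → K) {c : K} (hc : c ≠ 0) : absHeight (c • x) = absHeight x := by
  rw [absHeight, logHeight_smul_eq_logHeight x hc, absHeight]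

theorem absHeight_comp_le (f : ι → ι') (x : ι' → K) : absHeight (x ∘ f) ≤ absHeight x :=
  div_le_div_of_nonneg_right (logHeight_comp_le f x) (Nat.cast_nonneg _)

omit [Finite ι] in
theorem absHeight_eq_zero_of_subsingleton [Subsingleton ι] (x : ι → K) : absHeight x = 0 := by
  simp [absHeight]

/-- The archimedean weights sum to the degree of the field, so after normalization the constant is
`log c` for every number field. This is the source of the independence of the final constant from
`K` and `L`. -/
theorem absHeight_le_of_forall_le {y : ι' → K} {z : ι → K} {c : ℝ} (hc : 1 ≤ c)
    (h0 : z = 0 → y = 0)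
    (harch : ∀ v ∈ archAbsVal (K := K), ∀ j, v (y j) ≤ c * ⨆ i, v (z i))
    (hna : ∀ v ∈ nonarchAbsVal (K := K), ∀ j, v (y j) ≤ ⨆ i, v (z i)) :
    absHeight y ≤ Real.log c + absHeight z := by
  have h := Real.log_le_log (mulHeight_pos y) (mulHeight_le_of_forall_le hc h0 harch hna)
  rw [Real.log_mul (pow_ne_zero _ (by linarith)) (mulHeight_ne_zero z), Real.log_pow,
    NumberField.totalWeight_eq_finrank, ← logHeight_eq_log_mulHeight,
    ← logHeight_eq_log_mulHeight] at h
  have h2 := finrank_pos_real (K := K)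
  rw [absHeight, absHeight, div_le_iff₀ h2, add_mul, div_mul_cancel₀ _ h2.ne']
  linarith

theorem absHeight_le_of_forall_eq {y : ι' → K} {z : ι → K}
    (h : ∀ j, y j = 0 ∨ ∃ i, y j = z i ∨ y j = - z i) : absHeight y ≤ absHeight z := by
  have key : ∀ v : AbsoluteValue K ℝ, ∀ j, v (y j) ≤ ⨆ i, v (z i) := by
    intro v j
    rcases h j with h | ⟨i, h | h⟩
    · rw [h, map_zero]
      exact Real.iSup_nonneg_of_nonnegHomClass v _
    · rw [h]
      exact Finite.le_ciSup_of_le i le_rfl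
    · rw [h, v.map_neg]
      exact Finite.le_ciSup_of_le i le_rfl
  have := absHeight_le_of_forall_le (y := y) (z := z) le_rfl ?_
    (fun v _ j => by rw [one_mul]; exact key v j) fun v _ j => key v j
  · simpa using this
  · intro hz
    funext j
    rcases h j with h | ⟨i, h | h⟩ <;> simp [h, hz]

/-- Only archimedean places see the number of summands. -/
theorem absHeight_sum_le [Fintype κ] (T : ι → κ → K) :
    absHeight (fun j => ∑ i, T j i)
      ≤ Real.log (Fintype.card κ) + absHeight fun p : ι × κ => T p.1 p.2 := by
  rcases isEmpty_or_nonempty κ with hκ | hκ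
  · have : (fun j => ∑ i, T j i) = 0 := by
      funext j
      simp
    rw [this, absHeight_zero]
    simpa using absHeight_nonneg fun p : ι × κ => T p.1 p.2
  refine absHeight_le_of_forall_le (by exact_mod_cast Fintype.card_pos) ?_ ?_ ?_
  · intro h
    funext j
    exact Finset.sum_eq_zero fun i _ => congrFun h (j, i)
  · intro v _ j
    refine (v.sum_le _ _).trans ?_
    refine (Finset.sum_le_card_nsmul _ _ (⨆ p : ι × κ, v (T p.1 p.2)) fun i _ => ?_).trans ?_
    · exact Finite.le_ciSup_of_le (f := fun p : ι × κ => v (T p.1 p.2)) (j, i) le_rfl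
    · rw [nsmul_eq_mul, Finset.card_univ]
  · intro v hv j
    refine ((isNonarchimedean v hv).apply_sum_univ_le).trans ?_
    exact ciSup_le fun i =>
      Finite.le_ciSup_of_le (f := fun p : ι × κ => v (T p.1 p.2)) (j, i) le_rfl

theorem absHeight_mul_le (x : ι → K) (y : ι' → K) :
    absHeight (fun p : ι × ι' => x p.1 * y p.2) ≤ absHeight x + absHeight y := by
  rcases eq_or_ne x 0 with rfl | hx
  · have : (fun p : ι × ι' => (0 : ι → K) p.1 * y p.2) = 0 := by
      funext p
      simp
    rw [this]
    simpa [absHeight_zero] using absHeight_nonneg y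
  rcases eq_or_ne y 0 with rfl | hy
  · have : (fun p : ι × ι' => x p.1 * (0 : ι' → K) p.2) = 0 := by
      funext p
      simp
    rw [this]
    simpa [absHeight_zero] using absHeight_nonneg x
  rw [absHeight, logHeight_fun_mul_eq hx hy, add_div, absHeight, absHeight]

theorem absHeight_prod_le (x : ι → K) (n : ℕ) :
    absHeight (fun I : Fin n → ι => ∏ a, x (I a)) ≤ n * absHeight x := by
  rcases eq_or_ne x 0 with rfl | hx
  · rw [absHeight_zero, mul_zero]
    rcases Nat.eq_zero_or_pos n with rfl | hn
    · rw [absHeight_eq_zero_of_subsingleton]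
    · have : (fun I : Fin n → ι => ∏ a, (0 : ι → K) (I a)) = 0 := by
        funext I
        exact Finset.prod_eq_zero (Finset.mem_univ ⟨0, hn⟩) rfl
      rw [this, absHeight_zero]
  · rw [absHeight, logHeight_fun_prod_eq (x := fun _ : Fin n => x) fun _ => hx]
    simp [absHeight, mul_div_assoc]

theorem absHeight_det_le {n : ℕ} (B : ι' → Matrix (Fin n) (Fin n) K) (x : ι → K)
    (hB : ∀ j a b, B j a b = 0 ∨ ∃ i, B j a b = x i) :
    absHeight (fun j => (B j).det) ≤ Real.log (n.factorial) + n * absHeight x := by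
  simp only [Matrix.det_apply]
  refine (absHeight_sum_le fun j (σ : Equiv.Perm (Fin n)) =>
    Equiv.Perm.sign σ • ∏ i, B j (σ i) i).trans ?_
  rw [Fintype.card_perm, Fintype.card_fin]
  gcongr
  refine (absHeight_le_of_forall_eq (z := fun I : Fin n → ι => ∏ a, x (I a)) ?_).trans
    (absHeight_prod_le x n)
  rintro ⟨j, σ⟩
  by_cases h : ∃ i, B j (σ i) i = 0
  · obtain ⟨i, hi⟩ := h
    left
    simp only
    rw [Finset.prod_eq_zero (f := fun i => B j (σ i) i) (Finset.mem_univ i) hi, smul_zero]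
  · right
    push Not at h
    choose I hI using fun i => (hB j (σ i) i).resolve_left (h i)
    refine ⟨I, ?_⟩
    simp only [hI]
    rcases Int.units_eq_one_or (Equiv.Perm.sign σ) with h | h <;> simp [h]

/-- The entries of the adjugate are, up to sign, minors of size `n`, not `n + 1`. -/
theorem absHeight_adjugate_le {n : ℕ} (B : Matrix (Fin (n + 1)) (Fin (n + 1)) K) (x : ι → K)
    (hB : ∀ a b, B a b = 0 ∨ ∃ i, B a b = x i) :
    absHeight (fun p : Fin (n + 1) × Fin (n + 1) => B.adjugate p.1 p.2)
      ≤ Real.log (n.factorial) + n * absHeight x := by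
  refine le_trans ?_ (absHeight_det_le (fun p : Fin (n + 1) × Fin (n + 1) =>
    B.submatrix p.2.succAbove p.1.succAbove) x fun p a b => hB _ _)
  refine absHeight_le_of_forall_eq fun p => Or.inr ⟨p, ?_⟩
  rw [Matrix.adjugate_fin_succ_eq_det_submatrix]
  rcases neg_one_pow_eq_or K ((p.2 : ℕ) + p.1) with h | h <;> simp [h]

/-- The height of solutions of a linear system, by Cramer's rule. -/
theorem absHeight_le_of_vecMul_eq [Finite τ] {α β : Type*} [Finite α] [Finite β] {n : ℕ}
    (B : Matrix (Fin (n + 1)) (Fin (n + 1)) K) (hdet : B.det ≠ 0) (x : ι → K)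
    (hB : ∀ a b, B a b = 0 ∨ ∃ i, B a b = x i) (u : Fin (n + 1) → K)
    (y : α → K) (z : β → K) (f : Fin (n + 1) → α) (g : Fin (n + 1) → β)
    (hu : ∀ c, ∑ r, u r * B r c = y (f c) * z (g c)) (θ : τ → Fin (n + 1)) :
    absHeight (u ∘ θ) ≤ Real.log (n + 1) + Real.log n.factorial + n * absHeight x
      + absHeight y + absHeight z := by
  have h3 : B.det • (u ∘ θ) = fun t => ∑ c, y (f c) * z (g c) * B.adjugate c (θ t) := by
    funext t
    exact det_mul_eq_sum_adjugate B u _ hu (θ t)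
  rw [← absHeight_smul (u ∘ θ) hdet, h3]
  refine (absHeight_sum_le fun t c => y (f c) * z (g c) * B.adjugate c (θ t)).trans ?_
  have h4 := absHeight_adjugate_le B x hB
  have h5 : absHeight (fun p : τ × Fin (n + 1) =>
      y (f p.2) * z (g p.2) * B.adjugate p.2 (θ p.1)) ≤ absHeight y + absHeight z +
      absHeight (fun p : Fin (n + 1) × Fin (n + 1) => B.adjugate p.1 p.2) := by
    refine le_trans ?_ ((absHeight_mul_le (fun p : α × β => y p.1 * z p.2)
      (fun p : Fin (n + 1) × Fin (n + 1) => B.adjugate p.1 p.2)).trans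
      (add_le_add (absHeight_mul_le y z) le_rfl))
    exact absHeight_comp_le (fun p : τ × Fin (n + 1) => ((f p.2, g p.2), (p.2, θ p.1)))
      (fun p : (α × β) × Fin (n + 1) × Fin (n + 1) =>
        y p.1.1 * z p.1.2 * B.adjugate p.2.1 p.2.2)
  rw [Fintype.card_fin]
  push_cast
  linarith

/-! ### Heights of tuples of polynomials -/

/-- The height of the tuple of the coefficients up to degree `n` of a tuple of polynomials. -/
noncomputable def polyHeight (n : ℕ) (q : ι → K[X]) : ℝ :=
  absHeight fun p : ι × Fin (n + 1) => (q p.1).coeff p.2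

theorem polyHeight_nonneg (n : ℕ) (q : ι → K[X]) : 0 ≤ polyHeight n q :=
  absHeight_nonneg _

/-- The coefficients beyond the degree vanish, so the truncation degree `N` on the left is
arbitrary. -/
theorem polyHeight_le_of_natDegree_le {n : ℕ} {p : ι → K[X]} {q : ι' → K[X]}
    (hq : ∀ i, (q i).natDegree ≤ n) (N : ℕ)
    (h : ∀ j, p j = 0 ∨ ∃ i, p j = q i ∨ p j = - q i) : polyHeight N p ≤ polyHeight n q := by
  refine absHeight_le_of_forall_eq fun ⟨j, k⟩ => ?_
  rcases h j with h | ⟨i, h⟩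
  · left
    simp [h]
  by_cases hk : (k : ℕ) ≤ n
  · right
    refine ⟨(i, ⟨k, by omega⟩), ?_⟩
    rcases h with h | h
    · left
      simp [h]
    · right
      simp [h]
  · left
    have := hq i
    have h0 : (q i).coeff k = 0 := coeff_eq_zero_of_natDegree_lt (by omega)
    rcases h with h | h <;> simp [h, h0]

/-- A coefficient of the product is a sum of at most `m + 1` terms, where `m` bounds the degree of
the second factor only. With one factor added at a time, the cost of a product of `r` factors
therefore stays linear in `r`. -/
theorem polyHeight_mul_le {n m : ℕ} (p : ι → K[X]) (q : ι' → K[X])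
    (hp : ∀ i, (p i).natDegree ≤ n) (hq : ∀ i, (q i).natDegree ≤ m) (N : ℕ) :
    polyHeight N (fun r : ι × ι' => p r.1 * q r.2)
      ≤ Real.log (m + 1) + polyHeight n p + polyHeight m q := by
  have h1 : (fun r : (ι × ι') × Fin (N + 1) => (p r.1.1 * q r.1.2).coeff r.2)
      = fun r => ∑ a : Fin (m + 1),
        if (a : ℕ) ≤ r.2 then (p r.1.1).coeff (r.2 - a) * (q r.1.2).coeff a else 0 := by
    funext ⟨⟨i, j⟩, k⟩
    simp only
    rw [Fin.sum_univ_eq_sum_range (fun a => if a ≤ (k : ℕ) then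
      (p i).coeff (k - a) * (q j).coeff a else 0) (m + 1), mul_comm, coeff_mul,
      Finset.Nat.sum_antidiagonal_eq_sum_range_succ (fun a b => (q j).coeff a * (p i).coeff b)]
    rw [← Finset.sum_filter]
    have h2 : ∑ a ∈ Finset.range (k + 1), (q j).coeff a * (p i).coeff (k - a)
        = ∑ a ∈ Finset.range (k + 1) with a < m + 1, (q j).coeff a * (p i).coeff (k - a) := by
      rw [Finset.sum_filter_of_ne]
      intro a _ ha
      by_contra h
      apply ha
      have := hq j
      rw [coeff_eq_zero_of_natDegree_lt (by omega), zero_mul]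
    rw [h2]
    refine Finset.sum_congr ?_ fun a _ => mul_comm _ _
    ext a
    simp only [Finset.mem_filter, Finset.mem_range]
    omega
  unfold polyHeight
  rw [h1]
  refine (absHeight_sum_le fun (r : (ι × ι') × Fin (N + 1)) (a : Fin (m + 1)) =>
    if (a : ℕ) ≤ r.2 then (p r.1.1).coeff (r.2 - a) * (q r.1.2).coeff a else 0).trans ?_
  rw [Fintype.card_fin, add_assoc]
  push_cast
  gcongr
  refine le_trans (absHeight_le_of_forall_eq fun s => ?_)
    (absHeight_mul_le (fun r : ι × Fin (n + 1) => (p r.1).coeff r.2)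
      (fun r : ι' × Fin (m + 1) => (q r.1).coeff r.2))
  obtain ⟨⟨⟨i, j⟩, k⟩, a⟩ := s
  simp only
  split_ifs with hak
  · by_cases hn : (k : ℕ) - a ≤ n
    · right
      exact ⟨((i, ⟨(k : ℕ) - a, by omega⟩), (j, a)), Or.inl rfl⟩
    · left
      have := hp i
      rw [coeff_eq_zero_of_natDegree_lt (by omega), zero_mul]
  · exact Or.inl rfl

theorem polyHeight_prod_le {n : ℕ} (q : ι → K[X]) (hq : ∀ i, (q i).natDegree ≤ n) (r N : ℕ) :
    polyHeight N (fun I : Fin r → ι => ∏ a, q (I a))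
      ≤ r * (Real.log (n + 1) + polyHeight n q) := by
  induction r generalizing N with
  | zero =>
    simp only [Finset.univ_eq_empty, Finset.prod_empty, Nat.cast_zero, zero_mul]
    refine (absHeight_le_of_forall_eq (z := fun _ : Unit => (1 : K)) fun s => ?_).trans
      (absHeight_eq_zero_of_subsingleton _).le
    rw [coeff_one]
    split_ifs
    · exact Or.inr ⟨(), Or.inl rfl⟩
    · exact Or.inl rfl
  | succ r ih =>
    have hd : ∀ I : Fin r → ι, (∏ a, q (I a)).natDegree ≤ r * n := fun I => by
      refine (natDegree_prod_le _ _).trans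
        ((Finset.sum_le_card_nsmul _ _ n fun a _ => hq (I a)).trans ?_)
      simp
    have h1 := polyHeight_mul_le (fun I : Fin r → ι => ∏ a, q (I a)) q hd hq (r * n + n)
    have h2 := ih (r * n)
    have h3 : ∀ s : (Fin r → ι) × ι, ((∏ a, q (s.1 a)) * q s.2).natDegree ≤ r * n + n := fun s =>
      natDegree_mul_le.trans (add_le_add (hd s.1) (hq s.2))
    have h4 : polyHeight N (fun I : Fin (r + 1) → ι => ∏ a, q (I a))
        ≤ polyHeight (r * n + n) fun s : (Fin r → ι) × ι => (∏ a, q (s.1 a)) * q s.2 := by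
      refine polyHeight_le_of_natDegree_le h3 N fun I => Or.inr
        ⟨(fun a => I a.castSucc, I (Fin.last r)), Or.inl ?_⟩
      exact Fin.prod_univ_castSucc _
    push_cast
    linarith

theorem polyHeight_sum_le [Fintype κ] (N : ℕ) (T : ι → κ → K[X]) :
    polyHeight N (fun j => ∑ i, T j i)
      ≤ Real.log (Fintype.card κ) + polyHeight N fun p : ι × κ => T p.1 p.2 := by
  unfold polyHeight
  simp only [finsetSum_coeff]
  refine (absHeight_sum_le fun (p : ι × Fin (N + 1)) i => (T p.1 i).coeff p.2).trans ?_
  gcongr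
  exact absHeight_comp_le (fun s : (ι × Fin (N + 1)) × κ => ((s.1.1, s.2), s.1.2))
    (fun p : (ι × κ) × Fin (N + 1) => (T p.1.1 p.1.2).coeff p.2)

theorem polyHeight_det_le {n N : ℕ} (B : Matrix (Fin n) (Fin n) K[X]) {m : ℕ} (q : ι → K[X])
    (hq : ∀ i, (q i).natDegree ≤ m) (hB : ∀ a b, B a b = 0 ∨ ∃ i, B a b = q i) :
    polyHeight N (fun _ : Unit => B.det)
      ≤ Real.log (n.factorial) + n * (Real.log (m + 1) + polyHeight m q) := by
  simp only [Matrix.det_apply]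
  refine (polyHeight_sum_le N fun (_ : Unit) (σ : Equiv.Perm (Fin n)) =>
    Equiv.Perm.sign σ • ∏ i, B (σ i) i).trans ?_
  rw [Fintype.card_perm, Fintype.card_fin]
  gcongr
  refine (polyHeight_le_of_natDegree_le (n := n * m) (q := fun I : Fin n → ι => ∏ a, q (I a))
    (fun I => ?_) N ?_).trans (polyHeight_prod_le q hq n _)
  · refine (natDegree_prod_le _ _).trans ((Finset.sum_le_card_nsmul _ _ m fun a _ => hq _).trans ?_)
    simp
  rintro ⟨j, σ⟩
  by_cases h : ∃ i, B (σ i) i = 0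
  · obtain ⟨i, hi⟩ := h
    left
    simp only
    rw [Finset.prod_eq_zero (f := fun i => B (σ i) i) (Finset.mem_univ i) hi, smul_zero]
  · right
    push Not at h
    choose I hI using fun i => (hB (σ i) i).resolve_left (h i)
    refine ⟨I, ?_⟩
    simp only [hI]
    rcases Int.units_eq_one_or (Equiv.Perm.sign σ) with h | h <;> simp [h]

omit [NumberField K] in
theorem natDegree_det_le {n : ℕ} (B : Matrix (Fin n) (Fin n) K[X]) {m : ℕ}
    (hB : ∀ a b, (B a b).natDegree ≤ m) : B.det.natDegree ≤ n * m := by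
  rw [Matrix.det_apply]
  refine natDegree_sum_le_of_forall_le _ _ fun σ _ => ?_
  refine (natDegree_smul_le _ _).trans ?_
  refine (natDegree_prod_le _ _).trans ((Finset.sum_le_card_nsmul _ _ m fun a _ => hB _ _).trans ?_)
  simp

theorem absHeight_pow_le (a : K) (n : ℕ) :
    absHeight (fun j : Fin (n + 1) => a ^ (j : ℕ)) ≤ n * absHeight ![a, 1] := by
  refine le_trans (absHeight_le_of_forall_eq fun j => Or.inr ?_) (absHeight_prod_le ![a, 1] n)
  -- `a ^ j` is a product of `n` entries of `![a, 1]`, the first `j` of them equal to `a`.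
  refine ⟨fun i => if (i : ℕ) < j then 0 else 1, Or.inl ?_⟩
  have : ∀ i : Fin n, (![a, 1] : Fin 2 → K) (if (i : ℕ) < j then 0 else 1)
      = if (i : ℕ) < j then a else 1 := fun i => by split_ifs <;> simp
  simp only [this]
  rw [Fin.prod_univ_eq_prod_range (fun i => if i < (j : ℕ) then a else 1) n, ← Finset.prod_filter,
    Finset.prod_const]
  congr 1
  have : Finset.filter (fun i => i < (j : ℕ)) (Finset.range n) = Finset.range j := by
    ext i
    simp only [Finset.mem_filter, Finset.mem_range]
    omega
  rw [this, Finset.card_range]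

theorem absHeight_eval_le {n : ℕ} (q : ι → K[X]) (hq : ∀ i, (q i).natDegree ≤ n) (a : K) :
    absHeight (fun i => (q i).eval a)
      ≤ Real.log (n + 1) + polyHeight n q + n * absHeight ![a, 1] := by
  have h1 : (fun i => (q i).eval a) = fun i => ∑ j : Fin (n + 1),
      (q i).coeff j * a ^ (j : ℕ) := by
    funext i
    rw [eval_eq_sum_range' (Nat.lt_succ_of_le (hq i)), Finset.sum_range]
  rw [h1]
  refine (absHeight_sum_le fun i (j : Fin (n + 1)) => (q i).coeff j * a ^ (j : ℕ)).trans ?_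
  rw [Fintype.card_fin, add_assoc]
  push_cast
  gcongr
  refine le_trans ?_ ((absHeight_mul_le (fun p : ι × Fin (n + 1) => (q p.1).coeff p.2)
    (fun j : Fin (n + 1) => a ^ (j : ℕ))).trans (add_le_add le_rfl (absHeight_pow_le a n)))
  exact absHeight_comp_le (fun p : ι × Fin (n + 1) => (p, p.2))
    (fun p : (ι × Fin (n + 1)) × Fin (n + 1) => (q p.1.1).coeff p.1.2 * a ^ (p.2 : ℕ))

end AbsHeight

end ProjDyn

namespace ProjDyn

open Height AdmissibleAbsValues NumberField

/-! ### Gelfond's inequality and heights of roots -/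

section Gelfond

variable {K : Type*} [Field K] [NumberField K] {ι : Type*} [Finite ι]

/-- The Mahler measure is multiplicative. It bounds the coefficients up to `2 ^ deg`, and is itself
bounded by the sum of their absolute values. -/
theorem norm_coeff_mul_norm_coeff_le {n : ℕ} {f g : ℂ[X]} (hn : (f * g).natDegree ≤ n)
    {s : ℝ} (hs : ∀ l, ‖(f * g).coeff l‖ ≤ s) (j k : ℕ) :
    ‖f.coeff j‖ * ‖g.coeff k‖ ≤ 2 ^ n * (n + 1) * s := by
  have hs0 : 0 ≤ s := (norm_nonneg _).trans (hs 0)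
  rcases eq_or_ne f 0 with rfl | hf
  · simp only [coeff_zero, norm_zero, zero_mul]
    positivity
  rcases eq_or_ne g 0 with rfl | hg
  · simp only [coeff_zero, norm_zero, mul_zero]
    positivity
  have h1 : ∀ (p : ℂ[X]) (j : ℕ), ‖p.coeff j‖ ≤ 2 ^ p.natDegree * p.mahlerMeasure := fun p j => by
    refine (norm_coeff_le_choose_mul_mahlerMeasure j p).trans ?_
    gcongr
    · exact mahlerMeasure_nonneg p
    · exact_mod_cast Nat.choose_le_two_pow _ _
  have h2 : (f * g).mahlerMeasure ≤ (n + 1) * s := by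
    refine (mahlerMeasure_le_sum_norm_coeff _).trans ?_
    rw [sum_over_range' _ (fun _ => norm_zero) (n + 1) (by omega)]
    refine (Finset.sum_le_card_nsmul _ _ s fun l _ => hs l).trans ?_
    simp
  calc ‖f.coeff j‖ * ‖g.coeff k‖
      ≤ (2 ^ f.natDegree * f.mahlerMeasure) * (2 ^ g.natDegree * g.mahlerMeasure) := by
        gcongr
        · exact mul_nonneg (by positivity) (mahlerMeasure_nonneg f)
        · exact h1 f j
        · exact h1 g k
    _ = 2 ^ (f * g).natDegree * (f * g).mahlerMeasure := by
        rw [mahlerMeasure_mul, natDegree_mul hf hg, pow_add]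
        ring
    _ ≤ 2 ^ n * ((n + 1) * s) := by
        gcongr
        · exact mahlerMeasure_nonneg _
        · norm_num
    _ = _ := by ring

/-- An inequality of Gelfond: the height of a factor of a tuple of polynomials. -/
theorem polyHeight_le_of_mul_eq {n : ℕ} {x q : ι → K[X]} {g : K[X]} (hg : g ≠ 0)
    (hx : ∀ i, x i * g = q i) (hq : ∀ i, (q i).natDegree ≤ n) :
    polyHeight n x ≤ polyHeight n q + 2 * n := by
  classical
  have hlog : Real.log (2 ^ n * (n + 1)) ≤ 2 * n := by
    rw [Real.log_mul (by positivity) (by positivity), Real.log_pow]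
    have h1 : Real.log 2 ≤ 1 := by
      have := Real.log_le_sub_one_of_pos (x := 2) (by norm_num)
      linarith
    have h2 : Real.log (n + 1) ≤ n := by
      have := Real.log_le_sub_one_of_pos (x := (n : ℝ) + 1) (by positivity)
      linarith
    nlinarith [Nat.cast_nonneg (α := ℝ) n]
  set X : ι × Fin (n + 1) → K := fun p => (x p.1).coeff p.2 with hX
  set Q : ι × Fin (n + 1) → K := fun p => (q p.1).coeff p.2 with hQ
  set Y : Fin (g.natDegree + 1) → K := fun k => g.coeff k with hY
  change absHeight X ≤ absHeight Q + 2 * n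
  have hY0 : Y ≠ 0 := fun h => by
    have := congrFun h (Fin.last _)
    simp only [hY, Fin.val_last, Pi.zero_apply] at this
    exact hg (leadingCoeff_eq_zero.1 this)
  -- Scaling by a nonzero coefficient of `g` does not change the height, and it makes `X` a part of
  -- the tuple of products, which is compared with `Q` at each place.
  have hge : absHeight X ≤ absHeight (fun p : (ι × Fin (n + 1)) × Fin (g.natDegree + 1) =>
      X p.1 * Y p.2) := by
    obtain ⟨k, hk⟩ := Function.ne_iff.1 hY0
    rw [← absHeight_smul X hk]
    refine le_trans (le_of_eq ?_) (absHeight_comp_le (fun p => (p, k)) _)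
    congr 1
    funext p
    simp only [Pi.smul_apply, smul_eq_mul, Function.comp, mul_comm]
  refine hge.trans ((absHeight_le_of_forall_le (z := Q) (c := 2 ^ n * (n + 1)) ?_ ?_ ?_ ?_).trans ?_)
  · exact one_le_mul_of_one_le_of_one_le (one_le_pow₀ (by norm_num)) (by simp)
  · intro h
    have hx0 : ∀ i, x i = 0 := fun i => by
      have : q i = 0 := by
        ext l
        by_cases hl : l ≤ n
        · exact congrFun h (i, ⟨l, by omega⟩)
        · rw [coeff_eq_zero_of_natDegree_lt (by have := hq i; omega), coeff_zero]
      rw [← hx i] at this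
      exact (mul_eq_zero.1 this).resolve_right hg
    funext p
    simp [hX, hx0]
  · rintro v hv ⟨⟨i, j⟩, k⟩
    obtain ⟨φ, rfl⟩ := mem_multisetInfinitePlace.1 hv
    have hnorm : ∀ a, (place φ) a = ‖φ a‖ := fun a => rfl
    simp only [hnorm]
    have h1 := norm_coeff_mul_norm_coeff_le (f := (x i).map φ) (g := g.map φ) (n := n)
      (s := ⨆ p, ‖φ (Q p)‖) ?_ ?_ j k
    · simpa [hX, hY] using h1
    · rw [← Polynomial.map_mul, hx]
      exact (natDegree_map_le).trans (hq i)
    · intro l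
      rw [← Polynomial.map_mul, hx, coeff_map]
      by_cases hl : l ≤ n
      · exact Finite.le_ciSup_of_le (f := fun p => ‖φ (Q p)‖) (i, ⟨l, by omega⟩) le_rfl
      · rw [coeff_eq_zero_of_natDegree_lt (by have := hq i; omega), map_zero, norm_zero]
        exact Real.iSup_nonneg fun _ => norm_nonneg _
  · rintro v hv ⟨⟨i, j⟩, k⟩
    have hna := isNonarchimedean v hv
    -- At a nonarchimedean place Gauss's lemma takes the place of the Mahler measure, without any
    -- loss.
    have h1 := gaussNorm_mul (v := v) hna zero_lt_one (x i) g
    have h2 := (x i).le_gaussNorm v zero_le_one j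
    have h3 := g.le_gaussNorm v zero_le_one k
    rw [one_pow, mul_one] at h2 h3
    rw [hx] at h1
    obtain ⟨l, hl⟩ := (q i).exists_eq_gaussNorm v 1
    rw [one_pow, mul_one] at hl
    simp only [map_mul]
    refine (mul_le_mul h2 h3 (v.nonneg _) ((v.nonneg _).trans h2)).trans ?_
    rw [← h1, hl]
    by_cases hl : l ≤ n
    · exact Finite.le_ciSup_of_le (f := fun p => v (Q p)) (i, ⟨l, by omega⟩) le_rfl
    · rw [coeff_eq_zero_of_natDegree_lt (by have := hq i; omega), map_zero]
      exact Real.iSup_nonneg_of_nonnegHomClass v _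
  · linarith

/-- The height of a root of a polynomial. -/
theorem absHeight_root_le {n : ℕ} {S : K[X]} (hS : S ≠ 0) (hn : S.natDegree ≤ n) {a : K}
    (ha : S.eval a = 0) : absHeight ![a, 1] ≤ polyHeight n (fun _ : Unit => S) + 2 * n := by
  obtain ⟨g, hg⟩ := dvd_iff_isRoot.2 ha
  have hg0 : g ≠ 0 := by
    rintro rfl
    exact hS (by rw [hg, mul_zero])
  have hdeg : S.natDegree = 1 + g.natDegree := by
    rw [hg, natDegree_mul (X_sub_C_ne_zero a) hg0, natDegree_X_sub_C]
  -- The coefficients of the factor `X - a` form the point `(a, 1)` up to a sign.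
  refine le_trans ?_ (polyHeight_le_of_mul_eq (x := fun _ : Unit => X - C a) hg0
    (fun _ => hg.symm) fun _ => hn)
  refine absHeight_le_of_forall_eq fun i => Or.inr ?_
  fin_cases i
  · exact ⟨((), ⟨0, by omega⟩), Or.inr (by simp)⟩
  · exact ⟨((), ⟨1, by omega⟩), Or.inl (by simp [coeff_X])⟩

end Gelfond

/-! ### Invariance of the absolute height under field extension -/

section BaseChange

variable {K : Type*} [Field K] [NumberField K] {L : Type*} [Field L] [NumberField L] [Algebra K L]
  {ι : Type*} [Finite ι]

theorem prod_infinitePlace_eq_prod_embeddings (f : InfinitePlace K → ℝ) :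
    ∏ w, f w ^ w.mult = ∏ φ : K →+* ℂ, f (InfinitePlace.mk φ) := by
  classical
  rw [← Finset.prod_fiberwise Finset.univ InfinitePlace.mk]
  refine Finset.prod_congr rfl fun w _ => ?_
  rw [← InfinitePlace.card_filter_mk_eq, ← Finset.prod_const]
  refine Finset.prod_congr rfl fun φ hφ => ?_
  rw [(Finset.mem_filter.1 hφ).2]

/-- Every complex embedding of `K` has exactly `[L : K]` extensions to `L`. -/
theorem prod_embeddings_comp (f : (K →+* ℂ) → ℝ) :
    ∏ φ : L →+* ℂ, f (φ.comp (algebraMap K L)) = (∏ ψ : K →+* ℂ, f ψ) ^ Module.finrank K L := by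
  classical
  rw [← Finset.prod_fiberwise Finset.univ fun φ : L →+* ℂ => φ.comp (algebraMap K L),
    ← Finset.prod_pow]
  refine Finset.prod_congr rfl fun ψ _ => ?_
  rw [Finset.prod_congr rfl (g := fun _ => f ψ) fun φ hφ => by rw [(Finset.mem_filter.1 hφ).2],
    Finset.prod_const]
  congr 1
  let : Algebra K ℂ := ψ.toAlgebra
  have : FiniteDimensional K L := FiniteDimensional.right ℚ K L
  rw [← AlgHom.card K L ℂ, ← Fintype.card_subtype]
  refine Fintype.card_congr ⟨fun φ => ⟨φ.1, fun r => RingHom.congr_fun φ.2 r⟩,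
    fun φ => ⟨φ.toRingHom, RingHom.ext fun r => φ.commutes r⟩, fun _ => rfl, fun _ => rfl⟩

/-- For integral coordinates the finite part of the height is the inverse norm of the ideal that
they generate, and the norm of an extended ideal is the `[L : K]`-th power. This avoids the
decomposition of finite places; the infinite part is a product over embeddings. -/
theorem mulHeight_algebraMap_of_integral {x : ι → 𝓞 K} (hx : x ≠ 0) :
    mulHeight (fun i => algebraMap K L (x i)) = mulHeight (fun i => (x i : K)) ^ Module.finrank K L := by
  classical
  set y : ι → 𝓞 L := fun i => algebraMap (𝓞 K) (𝓞 L) (x i) with hy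
  have hy0 : y ≠ 0 := fun h => hx <| by
    funext i
    exact (FaithfulSMul.algebraMap_eq_zero_iff (𝓞 K) (𝓞 L)).1 (congrFun h i)
  have hyx : (fun i => algebraMap K L (x i)) = fun i => (y i : L) := rfl
  have hx' : (fun i => (x i : K)) ≠ 0 := fun h => hx <| by
    funext i
    exact RingOfIntegers.coe_eq_zero_iff.1 (congrFun h i)
  have hy' : (fun i => (y i : L)) ≠ 0 := fun h => hy0 <| by
    funext i
    exact RingOfIntegers.coe_eq_zero_iff.1 (congrFun h i)
  have hIK := absNorm_mul_finprod_finitePlace_eq_one hx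
  have hIL := absNorm_mul_finprod_finitePlace_eq_one hy0
  have hspan : Ideal.span (Set.range y) = (Ideal.span (Set.range x)).map (algebraMap (𝓞 K) (𝓞 L)) := by
    rw [Ideal.map_span, ← Set.range_comp]
    rfl
  have hrank : Module.finrank (𝓞 K) (𝓞 L) = Module.finrank K L :=
    (IsFractionRing.finrank_eq (𝓞 K) K (𝓞 L) L).symm
  rw [hspan, Ideal.absNorm_algebraMap, hrank] at hIL
  have hfin : (∏ᶠ v : FinitePlace L, ⨆ i, v (y i : L))
      = (∏ᶠ v : FinitePlace K, ⨆ i, v (x i : K)) ^ Module.finrank K L := by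
    have h0 : ((Ideal.absNorm (Ideal.span (Set.range x)) ^ Module.finrank K L : ℕ) : ℝ) ≠ 0 :=
      left_ne_zero_of_mul (hIL ▸ one_ne_zero)
    refine mul_left_cancel₀ h0 (hIL.trans ?_)
    push_cast
    rw [← mul_pow, hIK, one_pow]
  rw [hyx, NumberField.mulHeight_eq hy', NumberField.mulHeight_eq hx', mul_pow, hfin]
  congr 1
  rw [prod_infinitePlace_eq_prod_embeddings fun w => ⨆ i, w (y i : L),
    prod_infinitePlace_eq_prod_embeddings fun w => ⨆ i, w (x i : K),
    ← prod_embeddings_comp (L := L) fun ψ => ⨆ i, (InfinitePlace.mk ψ) (x i : K)]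
  rfl

theorem absHeight_algebraMap (x : ι → K) :
    absHeight (fun i => algebraMap K L (x i)) = absHeight x := by
  rcases eq_or_ne x 0 with rfl | hx
  · have : (fun i => algebraMap K L ((0 : ι → K) i)) = 0 := by
      funext i
      simp
    rw [this, absHeight_zero, absHeight_zero]
  obtain ⟨b, hb⟩ := IsLocalization.exist_integer_multiples_of_finite (nonZeroDivisors (𝓞 K)) x
  choose z hz using hb
  set c : K := ((b : 𝓞 K) : K)
  have hc : c ≠ 0 := by
    simp [c]
  have hzx : (fun i => (z i : K)) = c • x := by
    funext i
    refine (hz i).trans ?_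
    rw [Algebra.smul_def]
    rfl
  have hzx' : (fun i => algebraMap K L (z i : K)) = algebraMap K L c • fun i => algebraMap K L (x i) := by
    funext i
    rw [congrFun hzx i]
    simp
  have hz0 : z ≠ 0 := by
    rintro rfl
    have h1 : c • x = 0 := by
      rw [← hzx]
      funext i
      simp
    exact (smul_ne_zero hc hx) h1
  have h1 := mulHeight_algebraMap_of_integral (L := L) hz0
  rw [← absHeight_smul x hc, ← hzx, ← absHeight_smul _ (c := algebraMap K L c) (by simpa using hc),
    ← hzx', absHeight, absHeight, logHeight_eq_log_mulHeight, h1, Real.log_pow,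
    ← Module.finrank_mul_finrank ℚ K L, ← logHeight_eq_log_mulHeight]
  have h2 := finrank_pos_real (K := K)
  have : FiniteDimensional K L := FiniteDimensional.right ℚ K L
  have h3 : (0 : ℝ) < Module.finrank K L := by exact_mod_cast Module.finrank_pos
  push_cast
  field_simp

theorem polyHeight_map (n : ℕ) (q : ι → K[X]) :
    polyHeight n (fun i => (q i).map (algebraMap K L)) = polyHeight n q := by
  unfold polyHeight
  simp only [coeff_map]
  exact absHeight_algebraMap fun p : ι × Fin (n + 1) => (q p.1).coeff p.2

end BaseChange

end ProjDyn

namespace ProjDyn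

/-- A spanning family of vectors contains a basis, whose determinant does not vanish. -/
theorem exists_det_ne_zero {k κ : Type*} [Field k] {n : ℕ} (M : κ → Fin n → k)
    (hM : ∀ r, Pi.single r 1 ∈ Submodule.span k (Set.range M)) :
    ∃ σ : Fin n → κ, (Matrix.of fun r c => M (σ c) r).det ≠ 0 := by
  classical
  have htop : Submodule.span k (Set.range M) = ⊤ := by
    rw [eq_top_iff, ← (Pi.basisFun k (Fin n)).span_eq, Submodule.span_le]
    rintro _ ⟨r, rfl⟩
    rw [Pi.basisFun_apply]
    exact hM r
  obtain ⟨κ', a, -, hspan, hli⟩ := exists_linearIndependent' k M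
  rw [htop] at hspan
  let b := Module.Basis.mk hli hspan.ge
  have : Finite κ' := Module.Finite.finite_basis b
  have : Fintype κ' := Fintype.ofFinite _
  have hcard : Fintype.card (Fin n) = Fintype.card κ' := by
    rw [← Module.finrank_eq_card_basis b, Module.finrank_fin_fun, Fintype.card_fin]
  let e : Fin n ≃ κ' := Fintype.equivOfCardEq hcard
  refine ⟨a ∘ e, ?_⟩
  have hli' : LinearIndependent k fun c => M (a (e c)) := hli.comp e e.injective
  have h1 : IsUnit (Matrix.of fun c r => M (a (e c)) r) :=
    Matrix.linearIndependent_rows_iff_isUnit.1 hli'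
  have h2 := (Matrix.isUnit_iff_isUnit_det _).1 h1
  rw [← Matrix.det_transpose] at h2
  exact h2.ne_zero

/-! ### Lower bound for the height of a specialized point -/

section Univariate

variable {K : Type*} [Field K] {ι : Type*} [Fintype ι]

/-- All cofactors but the one of `x i₀` are reduced modulo `x i₀`, which has the maximal degree. The
remaining cofactor `e` absorbs the quotients, and its degree is then forced by comparison of
degrees. -/
theorem exists_combination_of_natDegree_lt {x : ι → K[X]} (hx : Ideal.span (Set.range x) = ⊤) {m : ℕ}
    (hdeg : ∀ i, (x i).natDegree ≤ m + 1) {i₀ : ι} (hi₀ : (x i₀).natDegree = m + 1)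
    {p : K[X]} (hp : p.natDegree < 2 * m + 2) :
    ∃ B : ι → K[X], (∀ i, (B i).natDegree < m + 1) ∧ ∑ i, B i * x i = p := by
  classical
  have hx0 : x i₀ ≠ 0 := by
    intro h
    rw [h] at hi₀
    simp at hi₀
  have hmem : p ∈ Ideal.span (Set.range x) := hx ▸ Submodule.mem_top
  obtain ⟨b, hb⟩ := (Ideal.mem_span_range_iff_exists_fun).1 hmem
  set c : ι → K[X] := fun i => b i % x i₀
  have hc : ∀ i, (c i).natDegree < m + 1 := fun i => by
    rw [← hi₀]
    exact natDegree_mod_lt _ (by omega)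
  set e : K[X] := b i₀ + ∑ i ∈ Finset.univ.erase i₀, (b i / x i₀) * x i with he
  have hsum : ∑ i ∈ Finset.univ.erase i₀, c i * x i + e * x i₀ = p := by
    rw [← hb, ← Finset.sum_erase_add _ _ (Finset.mem_univ i₀), he, add_mul, Finset.sum_mul]
    have : ∀ i, b i * x i = c i * x i + b i / x i₀ * x i * x i₀ := fun i => by
      have := EuclideanDomain.div_add_mod (b i) (x i₀)
      simp only [c]
      linear_combination (-(x i)) * this
    rw [Finset.sum_congr rfl fun i _ => this i, Finset.sum_add_distrib]
    ring
  have he2 : e.natDegree < m + 1 := by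
    rcases eq_or_ne e 0 with h0 | h0
    · rw [h0]
      simp
    have h1 : (e * x i₀).natDegree = e.natDegree + (m + 1) := by
      rw [natDegree_mul h0 hx0, hi₀]
    have h2 : (e * x i₀).natDegree ≤ 2 * m + 1 := by
      rw [← eq_sub_iff_add_eq'] at hsum
      rw [hsum]
      refine (natDegree_sub_le _ _).trans (max_le (by omega) ?_)
      refine natDegree_sum_le_of_forall_le _ _ fun i _ => natDegree_mul_le.trans ?_
      have := hc i
      have := hdeg i
      omega
    omega
  refine ⟨fun i => if i = i₀ then e else c i, fun i => ?_, ?_⟩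
  · simp only
    split_ifs
    · exact he2
    · exact hc i
  · rw [← hsum, ← Finset.sum_erase_add _ _ (Finset.mem_univ i₀)]
    dsimp only
    rw [if_pos rfl]
    congr 1
    refine Finset.sum_congr rfl fun i hi => ?_
    rw [if_neg (Finset.ne_of_mem_erase hi)]

/-- A lower bound for the height of a specialization of a tuple of polynomials without common
factor. -/
theorem natDegree_mul_absHeight_le [NumberField K] {x : ι → K[X]} (hx : Ideal.span (Set.range x) = ⊤)
    {m : ℕ} (hdeg : ∀ i, (x i).natDegree ≤ m + 1) {i₀ : ι} (hi₀ : (x i₀).natDegree = m + 1)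
    (a : K) : (m + 1 : ℝ) * absHeight ![a, 1] ≤ Real.log (2 * m + 2) + Real.log (2 * m + 1).factorial
      + (2 * m + 1) * polyHeight (m + 1) x + absHeight fun i => (x i).eval a := by
  classical
  -- A Sylvester matrix for several polynomials: the products `X ^ l * x i` with `l ≤ m` span all
  -- polynomials of degree at most `2 * m + 1`.
  let M : ι × Fin (m + 1) → Fin (2 * m + 1 + 1) → K := fun p r => (X ^ (p.2 : ℕ) * x p.1).coeff r
  have hM : ∀ r, Pi.single r 1 ∈ Submodule.span K (Set.range M) := by
    intro r
    obtain ⟨B, hB, hsum⟩ := exists_combination_of_natDegree_lt hx hdeg hi₀ (p := X ^ (r : ℕ))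
      (by rw [natDegree_X_pow]; exact r.2)
    have : (Pi.single r 1 : Fin (2 * m + 1 + 1) → K)
        = ∑ i, ∑ l : Fin (m + 1), (B i).coeff l • M (i, l) := by
      funext s
      have h1 : (X ^ (r : ℕ) : K[X]).coeff s = (Pi.single r 1 : Fin (2 * m + 1 + 1) → K) s := by
        rw [coeff_X_pow, Pi.single_apply]
        simp only [Fin.ext_iff]
      rw [← h1, ← hsum, finsetSum_coeff]
      simp only [Finset.sum_apply, Pi.smul_apply, smul_eq_mul, M]
      refine Finset.sum_congr rfl fun i _ => ?_
      conv_lhs => rw [(B i).as_sum_range' (m + 1) (hB i), Finset.sum_range, Finset.sum_mul,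
        finsetSum_coeff]
      refine Finset.sum_congr rfl fun l _ => ?_
      rw [← C_mul_X_pow_eq_monomial, mul_assoc, coeff_C_mul]
    rw [this]
    exact Submodule.sum_mem _ fun i _ => Submodule.sum_mem _ fun l _ =>
      Submodule.smul_mem _ _ (Submodule.subset_span ⟨(i, l), rfl⟩)
  obtain ⟨σ, hσ⟩ := exists_det_ne_zero M hM
  -- Cramer's rule recovers the powers of `a` from the products `a ^ l * x_i(a)`. The extreme powers
  -- `a ^ (2 * m + 1)` and `1` have height `(2 * m + 1) * h(a)`, of which the factors `a ^ l` cost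
  -- `m * h(a)`, so `(m + 1) * h(a)` remains.
  have h1 := absHeight_le_of_vecMul_eq _ hσ (fun p : ι × Fin (m + 1 + 1) => (x p.1).coeff p.2)
    (fun r c => ?_) (fun r => a ^ (r : ℕ)) (fun l : Fin (m + 1) => a ^ (l : ℕ))
    (fun i => (x i).eval a) (fun c => (σ c).2) (fun c => (σ c).1) (fun c => ?_)
    ![Fin.last _, 0]
  · have h2 : ((fun r : Fin (2 * m + 1 + 1) => a ^ (r : ℕ)) ∘ ![Fin.last _, 0])
        = ![a, 1] ^ (2 * m + 1) := by
      funext i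
      fin_cases i <;> simp
    have h3 : absHeight (![a, 1] ^ (2 * m + 1)) = (2 * m + 1) * absHeight ![a, 1] := by
      rw [absHeight, Height.logHeight_pow, absHeight]
      push_cast
      ring
    have h4 := absHeight_pow_le a m
    rw [h2, h3] at h1
    have h5 : polyHeight (m + 1) x
      = absHeight (fun p : ι × Fin (m + 1 + 1) => (x p.1).coeff p.2) := rfl
    rw [← h5] at h1
    push_cast at h1
    have h6 : (2 * m + 1 + 1 : ℝ) = 2 * m + 2 := by ring
    rw [h6] at h1
    linarith
  · simp only [Matrix.of_apply, M]
    rw [coeff_X_pow_mul']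
    split_ifs with hl
    · by_cases hr : (r : ℕ) - (σ c).2 ≤ m + 1
      · exact Or.inr ⟨((σ c).1, ⟨(r : ℕ) - (σ c).2, by omega⟩), rfl⟩
      · left
        have := hdeg (σ c).1
        exact coeff_eq_zero_of_natDegree_lt (by omega)
    · exact Or.inl rfl
  · simp only [Matrix.of_apply, M]
    have hd : (X ^ ((σ c).2 : ℕ) * x (σ c).1).natDegree < 2 * m + 1 + 1 := by
      have h2 := natDegree_mul_le (p := X ^ ((σ c).2 : ℕ)) (q := x (σ c).1)
      rw [natDegree_X_pow] at h2
      have := hdeg (σ c).1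
      have := (σ c).2.2
      omega
    have h3 : (X ^ ((σ c).2 : ℕ) * x (σ c).1).eval a = a ^ ((σ c).2 : ℕ) * (x (σ c).1).eval a := by
      rw [eval_mul, eval_pow, eval_X]
    rw [← h3, eval_eq_sum_range' hd, Finset.sum_range]
    exact Finset.sum_congr rfl fun r _ => mul_comm _ _

end Univariate

end ProjDyn

namespace ProjDyn

/-! ### Monomials and forms of degree `d` over a ring -/

section Monomials

variable {N d : ℕ}

theorem Mon.degree_eq (m : Mon N d) : m.1.degree = d := by
  have := (Finset.mem_finsuppAntidiag.1 m.2).1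
  rw [Finsupp.degree_eq_sum]
  exact this

/-- A monomial of degree `d` as an element of `Mon N d`. -/
def Mon.mk {m : Fin (N + 1) →₀ ℕ} (h : m.degree = d) : Mon N d :=
  ⟨m, by
    rw [Finset.mem_finsuppAntidiag, ← Finsupp.degree_eq_sum]
    exact ⟨h, Finset.subset_univ _⟩⟩

theorem Mon.le_degree (m : Mon N d) (i : Fin (N + 1)) : m.1 i ≤ d := by
  have h := m.degree_eq
  rw [Finsupp.degree_eq_sum] at h
  exact (Finset.single_le_sum (f := fun i => m.1 i) (fun _ _ => Nat.zero_le _)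
    (Finset.mem_univ i)).trans h.le

theorem card_mon_le : Fintype.card (Mon N d) ≤ (d + 1) ^ (N + 1) := by
  have h : Function.Injective fun (m : Mon N d) (i : Fin (N + 1)) =>
      (⟨m.1 i, Nat.lt_succ_of_le (m.le_degree i)⟩ : Fin (d + 1)) := by
    intro m m' h
    refine Subtype.ext (Finsupp.ext fun i => ?_)
    exact congrArg Fin.val (congrFun h i)
  simpa using Fintype.card_le_of_injective _ h

theorem exists_sum_single_eq {σ : Type*} (d : ℕ) (m : σ →₀ ℕ) (hm : m.degree = d) :
    ∃ I : Fin d → σ, ∑ a, Finsupp.single (I a) 1 = m := by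
  classical
  induction d generalizing m with
  | zero =>
    refine ⟨Fin.elim0, ?_⟩
    simp [(Finsupp.degree_eq_zero_iff m).1 hm]
  | succ d ih =>
    obtain ⟨i, hi⟩ : ∃ i, m i ≠ 0 := by
      by_contra! h
      have : m = 0 := Finsupp.ext h
      simp [this] at hm
    have hle : Finsupp.single i 1 ≤ m := by
      rw [Finsupp.single_le_iff]
      omega
    have hadd := tsub_add_cancel_of_le hle
    have hdeg : (m - Finsupp.single i 1).degree = d := by
      have := congrArg Finsupp.degree hadd
      rw [map_add, Finsupp.degree_single, hm] at this
      omega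
    obtain ⟨I, hI⟩ := ih _ hdeg
    refine ⟨Fin.snoc I i, ?_⟩
    rw [Fin.sum_univ_castSucc]
    simpa [hI] using hadd

variable {R : Type*} [CommRing R]

/-- The value of a monomial. -/
def monVal (v : Fin (N + 1) → R) (m : Mon N d) : R := ∏ i, v i ^ m.1 i

theorem exists_monVal_eq_prod (m : Mon N d) :
    ∃ I : Fin d → Fin (N + 1), ∀ v : Fin (N + 1) → R, monVal v m = ∏ a, v (I a) := by
  obtain ⟨I, hI⟩ := exists_sum_single_eq d m.1 m.degree_eq
  refine ⟨I, fun v => ?_⟩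
  unfold monVal
  simp only [← hI, Finsupp.coe_finsetSum, Finset.sum_apply, ← Finset.prod_pow_eq_pow_sum]
  rw [Finset.prod_comm]
  refine Finset.prod_congr rfl fun a _ => ?_
  rw [Finset.prod_eq_single (I a)]
  · simp
  · intro b _ hb
    simp [hb.symm]
  · simp

theorem eval_eq_sum_monVal {q : MvPolynomial (Fin (N + 1)) R} (hq : q.IsHomogeneous d)
    (v : Fin (N + 1) → R) :
    MvPolynomial.eval v q = ∑ m : Mon N d, q.coeff m.1 * monVal v m := by
  classical
  rw [MvPolynomial.eval_eq']
  have h1 : q.support ⊆ (Finset.univ : Finset (Fin (N + 1))).finsuppAntidiag d := by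
    intro m hm
    have h2 := hq (MvPolynomial.mem_support_iff.1 hm)
    have h3 : m.degree = d := by
      rw [Finsupp.degree_eq_weight_one]
      exact h2
    exact (Mon.mk h3).2
  rw [Finset.sum_subset h1]
  · exact (Finset.sum_coe_sort _ fun m => q.coeff m * ∏ i, v i ^ m i).symm
  · intro m _ hm
    rw [MvPolynomial.notMem_support_iff.1 hm, zero_mul]

/-- The forms of degree `d` with given coefficients in a commutative ring. -/
noncomputable def forms (c : Fin (N + 1) × Mon N d → R) :
    Fin (N + 1) → MvPolynomial (Fin (N + 1)) R :=
  fun i => ∑ m : Mon N d, MvPolynomial.monomial m.1 (c (i, m))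

theorem isHomogeneous_forms (c : Fin (N + 1) × Mon N d → R) (i : Fin (N + 1)) :
    (forms c i).IsHomogeneous d :=
  MvPolynomial.IsHomogeneous.sum _ _ _ fun m _ => MvPolynomial.isHomogeneous_monomial _ m.degree_eq

theorem coeff_forms (c : Fin (N + 1) × Mon N d → R) (i : Fin (N + 1)) (m : Mon N d) :
    (forms c i).coeff m.1 = c (i, m) := by
  classical
  unfold forms
  rw [MvPolynomial.coeff_sum, Finset.sum_eq_single m]
  · simp
  · intro b _ hb
    rw [MvPolynomial.coeff_monomial, if_neg fun h => hb (Subtype.ext h)]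
  · simp

theorem map_forms {R' : Type*} [CommRing R'] (φ : R →+* R') (c : Fin (N + 1) × Mon N d → R)
    (i : Fin (N + 1)) : MvPolynomial.map φ (forms c i) = forms (φ ∘ c) i := by
  simp [forms, MvPolynomial.map_monomial]

theorem forms_eq {q : Fin (N + 1) → MvPolynomial (Fin (N + 1)) R}
    (hq : ∀ i, (q i).IsHomogeneous d) : forms (fun p : Fin (N + 1) × Mon N d => (q p.1).coeff p.2.1) = q := by
  funext i
  ext m
  by_cases hm : m.degree = d
  · exact coeff_forms _ i (Mon.mk hm)
  · rw [(isHomogeneous_forms _ i).coeff_eq_zero hm, (hq i).coeff_eq_zero hm]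

/-- The values of forms with given coefficients. -/
noncomputable def formVal (c : Fin (N + 1) × Mon N d → R) (v : Fin (N + 1) → R) :
    Fin (N + 1) → R :=
  fun i => ∑ m : Mon N d, c (i, m) * monVal v m

theorem eval_forms (c : Fin (N + 1) × Mon N d → R) (v : Fin (N + 1) → R) (i : Fin (N + 1)) :
    MvPolynomial.eval v (forms c i) = formVal c v i := by
  rw [eval_eq_sum_monVal (isHomogeneous_forms c i)]
  simp only [coeff_forms, formVal]

theorem map_monVal {R' : Type*} [CommRing R'] (φ : R →+* R') (v : Fin (N + 1) → R) (m : Mon N d) :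
    φ (monVal v m) = monVal (φ ∘ v) m := by
  simp [monVal]

theorem map_formVal {R' : Type*} [CommRing R'] (φ : R →+* R') (c : Fin (N + 1) × Mon N d → R)
    (v : Fin (N + 1) → R) (i : Fin (N + 1)) :
    φ (formVal c v i) = formVal (φ ∘ c) (φ ∘ v) i := by
  simp [formVal, map_monVal]

theorem monVal_smul (a : R) (v : Fin (N + 1) → R) (m : Mon N d) :
    monVal (a • v) m = a ^ d * monVal v m := by
  obtain ⟨I, hI⟩ := exists_monVal_eq_prod (R := R) m
  simp [hI, Finset.prod_mul_distrib]

theorem formVal_smul (c : Fin (N + 1) × Mon N d → R) (a : R) (v : Fin (N + 1) → R) :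
    formVal c (a • v) = a ^ d • formVal c v := by
  funext i
  simp only [formVal, monVal_smul, Pi.smul_apply, smul_eq_mul, Finset.mul_sum]
  exact Finset.sum_congr rfl fun m _ => by ring

theorem formVal_smul_left (b : R) (c : Fin (N + 1) × Mon N d → R) (v : Fin (N + 1) → R) :
    formVal (b • c) v = b • formVal c v := by
  funext i
  simp only [formVal, Pi.smul_apply, smul_eq_mul, Finset.mul_sum]
  exact Finset.sum_congr rfl fun m _ => by ring

end Monomials

/-! ### Macaulay matrices -/

section Macaulay

variable {N d e E : ℕ} {R : Type*} [CommRing R]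

/-- The coefficients of the multiples of forms by monomials. -/
noncomputable def macaulay (c : Fin (N + 1) × Mon N d → R) (p : Fin (N + 1) × Mon N e)
    (m : Mon N E) : R :=
  (MvPolynomial.monomial p.2.1 1 * forms c p.1).coeff m.1

theorem macaulay_eq_zero_or (c : Fin (N + 1) × Mon N d → R) (p : Fin (N + 1) × Mon N e)
    (m : Mon N E) : macaulay c p m = 0 ∨ ∃ q, macaulay c p m = c q := by
  classical
  unfold macaulay
  rw [MvPolynomial.coeff_monomial_mul', one_mul]
  split_ifs
  · by_cases h : (m.1 - p.2.1).degree = d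
    · exact Or.inr ⟨(p.1, Mon.mk h), coeff_forms c p.1 (Mon.mk h)⟩
    · exact Or.inl ((isHomogeneous_forms c p.1).coeff_eq_zero h)
  · exact Or.inl rfl

/-- Compatibility with ring maps lets one minor serve over `K(t)`, where it is shown not to vanish,
over `K[t]`, where degrees and heights are measured, and over `L` after specialization. -/
theorem map_macaulay {R' : Type*} [CommRing R'] (φ : R →+* R') (c : Fin (N + 1) × Mon N d → R)
    (p : Fin (N + 1) × Mon N e) (m : Mon N E) : φ (macaulay c p m) = macaulay (φ ∘ c) p m := by
  unfold macaulay
  rw [← map_forms, ← MvPolynomial.coeff_map, map_mul, MvPolynomial.map_monomial, map_one]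

theorem sum_monVal_mul_macaulay (hE : e + d = E) (c : Fin (N + 1) × Mon N d → R)
    (p : Fin (N + 1) × Mon N e) (v : Fin (N + 1) → R) :
    ∑ m : Mon N E, monVal v m * macaulay c p m = monVal v p.2 * formVal c v p.1 := by
  have h : (MvPolynomial.monomial p.2.1 1 * forms c p.1).IsHomogeneous E :=
    hE ▸ (MvPolynomial.isHomogeneous_monomial 1 p.2.degree_eq).mul (isHomogeneous_forms c p.1)
  have h1 := eval_eq_sum_monVal h v
  rw [map_mul, eval_forms, MvPolynomial.eval_monomial, one_mul, Finsupp.prod_fintype _ _ (by simp)]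
    at h1
  refine Eq.trans ?_ h1.symm
  exact Finset.sum_congr rfl fun m _ => mul_comm _ _

/-- The square submatrix of the Macaulay matrix with given columns. -/
noncomputable def macaulayMinor {n : ℕ} (ε : Fin n ≃ Mon N E) (σ : Fin n → Fin (N + 1) × Mon N e)
    (c : Fin (N + 1) × Mon N d → R) : Matrix (Fin n) (Fin n) R :=
  Matrix.of fun r s => macaulay c (σ s) (ε r)

theorem map_det_macaulayMinor {R' : Type*} [CommRing R'] (φ : R →+* R') {n : ℕ}
    (ε : Fin n ≃ Mon N E) (σ : Fin n → Fin (N + 1) × Mon N e) (c : Fin (N + 1) × Mon N d → R) :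
    φ (macaulayMinor ε σ c).det = (macaulayMinor ε σ (φ ∘ c)).det := by
  rw [RingHom.map_det]
  congr 1
  ext r s
  exact map_macaulay φ c _ _

theorem macaulayMinor_eq_zero_or {n : ℕ} (ε : Fin n ≃ Mon N E)
    (σ : Fin n → Fin (N + 1) × Mon N e) (c : Fin (N + 1) × Mon N d → R) (r s : Fin n) :
    macaulayMinor ε σ c r s = 0 ∨ ∃ q, macaulayMinor ε σ c r s = c q :=
  macaulay_eq_zero_or c _ _

theorem sum_monVal_mul_macaulayMinor (hE : e + d = E) {n : ℕ} (ε : Fin n ≃ Mon N E)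
    (σ : Fin n → Fin (N + 1) × Mon N e) (c : Fin (N + 1) × Mon N d → R) (v : Fin (N + 1) → R)
    (s : Fin n) :
    ∑ r, monVal v (ε r) * macaulayMinor ε σ c r s = monVal v (σ s).2 * formVal c v (σ s).1 := by
  rw [← sum_monVal_mul_macaulay hE]
  exact Equiv.sum_comp ε fun m => monVal v m * macaulay c (σ s) m

/-- The monomial `x_i ^ E`. -/
noncomputable def purePow (N E : ℕ) (i : Fin (N + 1)) : Mon N E :=
  Mon.mk (Finsupp.degree_single i E)

theorem monVal_purePow (v : Fin (N + 1) → R) (i : Fin (N + 1)) :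
    monVal v (purePow N E i) = v i ^ E := by
  classical
  unfold monVal purePow Mon.mk
  rw [Finset.prod_eq_single i]
  · simp
  · intro b _ hb
    simp [hb.symm]
  · simp

/-- The certificate that replaces the resultant identity: Cramer's rule for the system whose
unknowns are the monomials of degree `E` in `v`. -/
theorem det_macaulayMinor_mul_pow (hE : e + d = E) {n : ℕ} (ε : Fin n ≃ Mon N E)
    (σ : Fin n → Fin (N + 1) × Mon N e) (c : Fin (N + 1) × Mon N d → R) (v : Fin (N + 1) → R)
    (i : Fin (N + 1)) :
    (macaulayMinor ε σ c).det * v i ^ E = ∑ s, monVal v (σ s).2 * formVal c v (σ s).1 *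
      (macaulayMinor ε σ c).adjugate s (ε.symm (purePow N E i)) := by
  have h := det_mul_eq_sum_adjugate (macaulayMinor ε σ c) (fun r => monVal v (ε r)) _
    (fun s => sum_monVal_mul_macaulayMinor hE ε σ c v s) (ε.symm (purePow N E i))
  rwa [Equiv.apply_symm_apply, monVal_purePow] at h

/-- A monomial of degree at least `(N + 1) * M` is divisible by some `X_i ^ M`, hence lies in the
ideal of the forms. Its cofactors can be taken homogeneous of degree `e`, so the columns of the
Macaulay matrix span. -/
theorem exists_det_macaulayMinor_ne_zero {k : Type*} [Field k] (hd : 0 < d)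
    (c : Fin (N + 1) × Mon N d → k)
    (h0 : ∀ x : Fin (N + 1) → AlgebraicClosure k,
      (∀ i, MvPolynomial.aeval x (forms c i) = 0) → x = 0)
    {M : ℕ} (hM : ((N + 1) * d + 1) ^ (N + 1) ≤ M) (hME : (N + 1) * M ≤ E) (hE : e + d = E)
    {n : ℕ} (ε : Fin n ≃ Mon N E) :
    ∃ σ : Fin n → Fin (N + 1) × Mon N e, (macaulayMinor ε σ c).det ≠ 0 := by
  classical
  refine exists_det_ne_zero (fun (p : Fin (N + 1) × Mon N e) r => macaulay c p (ε r)) fun r => ?_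
  have hX := fun i => MvPolynomial.X_pow_mem_span_of_no_common_zero hd (isHomogeneous_forms c) h0
    (M := M) (by simpa using hM) i
  have hmem := MvPolynomial.monomial_mem_of_X_pow_mem hX (m := (ε r).1)
    (by rw [Fintype.card_fin, (ε r).degree_eq]; exact hME) (by rw [(ε r).degree_eq]; omega) 1
  obtain ⟨A, hA, hsum⟩ := MvPolynomial.exists_homogeneousComponent_eq_sum (isHomogeneous_forms c)
    hmem (s := E) (by omega)
  have hhom : MvPolynomial.monomial (ε r).1 (1 : k) ∈ MvPolynomial.homogeneousSubmodule _ k E :=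
    MvPolynomial.isHomogeneous_monomial 1 (ε r).degree_eq
  rw [MvPolynomial.homogeneousComponent_of_mem hhom, if_pos rfl] at hsum
  have hAe : ∀ j, A j = ∑ m : Mon N e, MvPolynomial.monomial m.1 ((A j).coeff m.1) := fun j => by
    have hAj : ∀ j, (A j).IsHomogeneous e := fun j => by
      have := hA j
      rwa [show E - d = e by omega] at this
    exact (congrFun (forms_eq hAj) j).symm
  have : (Pi.single r 1 : Fin n → k) = ∑ j, ∑ m : Mon N e, (A j).coeff m.1 •
      fun s => macaulay c (j, m) (ε s) := by
    funext s
    have h1 : (MvPolynomial.monomial (ε r).1 (1 : k)).coeff (ε s).1 = (Pi.single r 1 : Fin n → k) s := by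
      rw [MvPolynomial.coeff_monomial, Pi.single_apply]
      simp only [Subtype.ext_iff.symm, ε.injective.eq_iff, eq_comm]
    rw [← h1, hsum, MvPolynomial.coeff_sum]
    simp only [Finset.sum_apply, Pi.smul_apply, smul_eq_mul]
    refine Finset.sum_congr rfl fun j _ => ?_
    conv_lhs => rw [hAe j, Finset.sum_mul, MvPolynomial.coeff_sum]
    refine Finset.sum_congr rfl fun m _ => ?_
    unfold macaulay
    rw [← MvPolynomial.coeff_C_mul, ← mul_assoc, MvPolynomial.C_mul_monomial, mul_one]
  rw [this]
  exact Submodule.sum_mem _ fun j _ => Submodule.sum_mem _ fun m _ =>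
    Submodule.smul_mem _ _ (Submodule.subset_span ⟨(j, m), rfl⟩)

/-- `g` divides `det * v_i ^ E` for every `i`, and the powers `v_i ^ E` generate the unit ideal
together with the `v_i`. This bounds the cancellation when `f` is applied to coprime coordinates. -/
theorem dvd_det_macaulayMinor (hE : e + d = E) {n : ℕ} (ε : Fin n ≃ Mon N E)
    (σ : Fin n → Fin (N + 1) × Mon N e) (c : Fin (N + 1) × Mon N d → R) {v : Fin (N + 1) → R}
    (hv : Ideal.span (Set.range v) = ⊤) {g : R} (hg : ∀ i, g ∣ formVal c v i) :
    g ∣ (macaulayMinor ε σ c).det := by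
  have h1 : ∀ i, (macaulayMinor ε σ c).det * v i ^ E ∈ Ideal.span {g} := fun i => by
    rw [det_macaulayMinor_mul_pow hE, Ideal.mem_span_singleton]
    exact Finset.dvd_sum fun s _ => ((hg _).mul_left _).mul_right _
  have h2 := Ideal.span_pow_eq_top _ hv E
  have h3 : (1 : R) ∈ Ideal.span ((fun x => x ^ E) '' Set.range v) := h2 ▸ Submodule.mem_top
  rw [← Ideal.mem_span_singleton, ← mul_one (macaulayMinor ε σ c).det]
  refine Submodule.span_induction (p := fun y _ => (macaulayMinor ε σ c).det * y ∈ Ideal.span {g})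
    ?_ ?_ ?_ ?_ h3
  · rintro _ ⟨_, ⟨i, rfl⟩, rfl⟩
    exact h1 i
  · simp
  · intro x y _ _ hx hy
    rw [mul_add]
    exact add_mem hx hy
  · intro a x _ hx
    rw [smul_eq_mul, mul_left_comm]
    exact Ideal.mul_mem_left _ _ hx

end Macaulay

/-! ### Height and degree bounds for the image of a point -/

section Bounds

variable {N d e E n : ℕ}

theorem absHeight_monVal_le {L : Type*} [Field L] [NumberField L] (v : Fin (N + 1) → L) :
    absHeight (fun m : Mon N d => monVal v m) ≤ d * absHeight v := by
  refine le_trans (absHeight_le_of_forall_eq fun m => Or.inr ?_) (absHeight_prod_le v d)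
  obtain ⟨I, hI⟩ := exists_monVal_eq_prod (R := L) m
  exact ⟨I, Or.inl (hI v)⟩

/-- The lower bound for the height of the image of a point under a morphism. -/
theorem mul_absHeight_le_formVal {L : Type*} [Field L] [NumberField L] (hE : e + d = E)
    (ε : Fin (n + 1) ≃ Mon N E) (σ : Fin (n + 1) → Fin (N + 1) × Mon N e)
    (c : Fin (N + 1) × Mon N d → L) (hdet : (macaulayMinor ε σ c).det ≠ 0)
    (v : Fin (N + 1) → L) :
    d * absHeight v ≤ Real.log (n + 1) + Real.log n.factorial + n * absHeight c
      + absHeight (formVal c v) := by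
  -- The pure powers have height `E * h(v)`, and the monomial multipliers cost `e * h(v)`; the
  -- difference is `d * h(v)`.
  have h1 := absHeight_le_of_vecMul_eq (macaulayMinor ε σ c) hdet c
    (macaulayMinor_eq_zero_or ε σ c) (fun r => monVal v (ε r)) (fun m : Mon N e => monVal v m)
    (formVal c v) (fun s => (σ s).2) (fun s => (σ s).1)
    (fun s => sum_monVal_mul_macaulayMinor hE ε σ c v s) fun i => ε.symm (purePow N E i)
  have h2 : ((fun r => monVal v (ε r)) ∘ fun i => ε.symm (purePow N E i)) = v ^ E := by
    funext i
    simp [monVal_purePow]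
  have h3 : absHeight (v ^ E) = E * absHeight v := by
    rw [absHeight, Height.logHeight_pow, absHeight, mul_div_assoc]
  have h4 := absHeight_monVal_le (d := e) v
  rw [h2, h3, ← hE] at h1
  push_cast at h1
  linarith

variable {K : Type*} [Field K] {h : ℕ}

theorem natDegree_macaulayMinor_le (ε : Fin n ≃ Mon N E) (σ : Fin n → Fin (N + 1) × Mon N e)
    {c : Fin (N + 1) × Mon N d → K[X]} (hc : ∀ p, (c p).natDegree ≤ h) (r s : Fin n) :
    (macaulayMinor ε σ c r s).natDegree ≤ h := by
  rcases macaulayMinor_eq_zero_or ε σ c r s with h0 | ⟨q, hq⟩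
  · simp [h0]
  · rw [hq]
    exact hc q

theorem natDegree_monVal_le {v : Fin (N + 1) → K[X]} {D : ℕ} (hv : ∀ i, (v i).natDegree ≤ D)
    (m : Mon N d) : (monVal v m).natDegree ≤ d * D := by
  obtain ⟨I, hI⟩ := exists_monVal_eq_prod (R := K[X]) m
  rw [hI]
  refine (natDegree_prod_le _ _).trans ((Finset.sum_le_card_nsmul _ _ D fun a _ => hv (I a)).trans ?_)
  simp

theorem natDegree_formVal_le {c : Fin (N + 1) × Mon N d → K[X]} (hc : ∀ p, (c p).natDegree ≤ h)
    {v : Fin (N + 1) → K[X]} {D : ℕ} (hv : ∀ i, (v i).natDegree ≤ D) (i : Fin (N + 1)) :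
    (formVal c v i).natDegree ≤ h + d * D :=
  natDegree_sum_le_of_forall_le _ _ fun m _ =>
    natDegree_mul_le.trans (add_le_add (hc _) (natDegree_monVal_le hv m))

/-- The analogue of `mul_absHeight_le_formVal` for the degree in `t`: degrees are compared in the
Cramer identity at a coordinate of maximal degree. -/
theorem mul_natDegree_le (hE : e + d = E) (ε : Fin (n + 1) ≃ Mon N E)
    (σ : Fin (n + 1) → Fin (N + 1) × Mon N e) {c : Fin (N + 1) × Mon N d → K[X]}
    (hc : ∀ p, (c p).natDegree ≤ h) (hdet : (macaulayMinor ε σ c).det ≠ 0)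
    {v : Fin (N + 1) → K[X]} {D D' : ℕ} (hv : ∀ i, (v i).natDegree ≤ D) {i : Fin (N + 1)}
    (hi : (v i).natDegree = D) (hD' : ∀ j, (formVal c v j).natDegree ≤ D') :
    d * D ≤ n * h + D' := by
  rcases Nat.eq_zero_or_pos D with rfl | hD
  · simp
  have hvi : v i ≠ 0 := by
    intro h0
    rw [h0, natDegree_zero] at hi
    omega
  have h1 := congrArg natDegree (det_macaulayMinor_mul_pow hE ε σ c v i)
  rw [natDegree_mul hdet (pow_ne_zero _ hvi), natDegree_pow, hi] at h1
  have h2 : (∑ s, monVal v (σ s).2 * formVal c v (σ s).1 *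
      (macaulayMinor ε σ c).adjugate s (ε.symm (purePow N E i))).natDegree ≤ e * D + D' + n * h := by
    refine natDegree_sum_le_of_forall_le _ _ fun s _ => natDegree_mul_le.trans (add_le_add
      (natDegree_mul_le.trans (add_le_add (natDegree_monVal_le hv _) (hD' _))) ?_)
    rw [Matrix.adjugate_fin_succ_eq_det_submatrix]
    refine natDegree_mul_le.trans ?_
    have h3 : ((-1 : K[X]) ^ (((ε.symm (purePow N E i) : Fin (n + 1)) : ℕ) + (s : ℕ))).natDegree = 0 := by
      rcases neg_one_pow_eq_or K[X] (((ε.symm (purePow N E i) : Fin (n + 1)) : ℕ) + (s : ℕ)) with h | h <;>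
        simp [h]
    rw [h3, zero_add]
    exact natDegree_det_le _ fun a b => natDegree_macaulayMinor_le ε σ hc _ _
  rw [← h1] at h2
  have h5 : E * D = e * D + d * D := by rw [← hE, add_mul]
  omega

end Bounds

end ProjDyn

namespace ProjDyn

/-! ### Coprime coordinates and the canonical height over `K(t)` -/

section Primitive

variable {K : Type*} [Field K] {ι : Type*} [Fintype ι]

theorem span_range_primitive (x : Projectivization (RatFunc K) (ι → RatFunc K)) :
    Ideal.span (Set.range (primitive x)) = ⊤ := by
  obtain ⟨r, hr⟩ := IsPrincipalIdealRing.principal (Ideal.span (Set.range (primitive x)))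
  have hr' : Ideal.span (Set.range (primitive x)) = Ideal.span {r} := hr
  rw [hr', Ideal.span_singleton_eq_top]
  refine (primitive_spec x).1 r fun i => ?_
  rw [← Ideal.mem_span_singleton, ← hr']
  exact Ideal.subset_span ⟨i, rfl⟩

theorem natDegree_primitive_le (x : Projectivization (RatFunc K) (ι → RatFunc K)) (i : ι) :
    (primitive x i).natDegree ≤ geomHeight x :=
  Finset.le_sup (f := fun i => (primitive x i).natDegree) (Finset.mem_univ i)

theorem exists_natDegree_primitive_eq [Nonempty ι]
    (x : Projectivization (RatFunc K) (ι → RatFunc K)) :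
    ∃ i, (primitive x i).natDegree = geomHeight x := by
  obtain ⟨i, -, hi⟩ := Finset.exists_mem_eq_sup Finset.univ Finset.univ_nonempty
    fun i => (primitive x i).natDegree
  exact ⟨i, hi.symm⟩

theorem geomHeight_le [Nonempty ι] {x : Projectivization (RatFunc K) (ι → RatFunc K)} {D : ℕ}
    (h : ∀ i, (primitive x i).natDegree ≤ D) : geomHeight x ≤ D := by
  obtain ⟨i, hi⟩ := exists_natDegree_primitive_eq x
  exact hi ▸ h i

theorem exists_rep_eq_smul_primitive (x : Projectivization (RatFunc K) (ι → RatFunc K)) :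
    ∃ γ : RatFunc K, γ ≠ 0 ∧ x.rep = γ • (algebraMap K[X] (RatFunc K) ∘ primitive x) := by
  obtain ⟨c, hc, h⟩ := (primitive_spec x).2
  exact ⟨c, hc, funext h⟩

theorem exists_eq_smul_primitive (v : ι → RatFunc K) (hv : v ≠ 0) :
    ∃ γ : RatFunc K, γ ≠ 0 ∧
      v = γ • (algebraMap K[X] (RatFunc K) ∘ primitive (Projectivization.mk _ v hv)) := by
  obtain ⟨b, hb⟩ := Projectivization.exists_smul_eq_mk_rep (RatFunc K) v hv
  obtain ⟨c, hc, h⟩ := exists_rep_eq_smul_primitive (Projectivization.mk _ v hv)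
  refine ⟨(b⁻¹ : (RatFunc K)ˣ) * c, mul_ne_zero (Units.ne_zero _) hc, ?_⟩
  rw [mul_smul, ← h, ← hb]
  exact (inv_smul_smul b v).symm

/-- A Bézout relation between the coprime coordinates, applied to `q`, exhibits the rational factor
`γ` as a polynomial. -/
theorem exists_eq_mul_of_smul_primitive {x : Projectivization (RatFunc K) (ι → RatFunc K)}
    {q : ι → K[X]} {γ : RatFunc K} (hγ : γ ≠ 0)
    (h : algebraMap K[X] (RatFunc K) ∘ q = γ • (algebraMap K[X] (RatFunc K) ∘ primitive x)) :
    ∃ g : K[X], g ≠ 0 ∧ ∀ i, q i = g * primitive x i := by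
  have h1 : (1 : K[X]) ∈ Ideal.span (Set.range (primitive x)) := by
    rw [span_range_primitive]
    exact Submodule.mem_top
  obtain ⟨l, hl⟩ := Ideal.mem_span_range_iff_exists_fun.1 h1
  have hinj : Function.Injective (algebraMap K[X] (RatFunc K)) := IsFractionRing.injective _ _
  have hi : ∀ i, algebraMap K[X] (RatFunc K) (q i)
      = γ * algebraMap K[X] (RatFunc K) (primitive x i) := fun i => congrFun h i
  have hg : algebraMap K[X] (RatFunc K) (∑ i, l i * q i) = γ := by
    rw [map_sum]
    simp only [map_mul, hi]
    have := congrArg (algebraMap K[X] (RatFunc K)) hl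
    rw [map_sum, map_one] at this
    simp only [map_mul] at this
    calc ∑ i, algebraMap K[X] (RatFunc K) (l i)
          * (γ * algebraMap K[X] (RatFunc K) (primitive x i))
        = γ * ∑ i, algebraMap K[X] (RatFunc K) (l i)
          * algebraMap K[X] (RatFunc K) (primitive x i) := by
          rw [Finset.mul_sum]
          exact Finset.sum_congr rfl fun i _ => mul_left_comm _ _ _
      _ = γ := by rw [this, mul_one]
  refine ⟨∑ i, l i * q i, fun h0 => hγ ?_, fun i => hinj ?_⟩
  · rw [← hg, h0, map_zero]
  · rw [map_mul, hg, hi]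

end Primitive

/-- The degree of the monomials used in the Macaulay matrices. -/
def macaulayDeg (N d : ℕ) : ℕ := (N + 1) * ((N + 1) * d + 1) ^ (N + 1)

theorem le_macaulayDeg (N d : ℕ) : d ≤ macaulayDeg N d := by
  have h1 : (N + 1) * d + 1 ≤ ((N + 1) * d + 1) ^ (N + 1) := Nat.le_self_pow (by omega) _
  have h2 : ((N + 1) * d + 1) ^ (N + 1) ≤ macaulayDeg N d := Nat.le_mul_of_pos_left _ (by omega)
  nlinarith [Nat.zero_le (N * d)]

namespace ProjEndo

variable {N d : ℕ}

theorem formVal_coeffs {k : Type*} [Field k] (f : ProjEndo k N d) (v : Fin (N + 1) → k) :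
    evalForms f.form v = formVal f.coeffs v := by
  funext i
  rw [← eval_forms]
  have h := forms_eq f.isHomogeneous
  exact congrArg (MvPolynomial.eval v) (congrFun h i).symm

variable {K : Type*} [Field K] (f : ProjEndo (RatFunc K) N d)

theorem exists_coeffs_eq_smul : ∃ γ : RatFunc K, γ ≠ 0 ∧
    f.coeffs = γ • (algebraMap K[X] (RatFunc K) ∘ primitive f.coeffPoint) :=
  exists_eq_smul_primitive f.coeffs f.coeffs_ne_zero

theorem exists_formVal_primitive (x : Projectivization (RatFunc K) (Fin (N + 1) → RatFunc K)) :
    ∃ g : K[X], g ≠ 0 ∧ ∀ i, formVal (primitive f.coeffPoint) (primitive x) i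
      = g * primitive (f.map x) i := by
  obtain ⟨γ, hγ, h1⟩ := f.exists_coeffs_eq_smul
  obtain ⟨c, hc, h2⟩ := exists_rep_eq_smul_primitive x
  obtain ⟨δ, hδ, h3⟩ := exists_eq_smul_primitive _ (f.evalForms_ne_zero x.rep_nonzero)
  refine exists_eq_mul_of_smul_primitive (γ := (γ * c ^ d)⁻¹ * δ)
    (mul_ne_zero (inv_ne_zero (mul_ne_zero hγ (pow_ne_zero _ hc))) hδ) ?_
  rw [mul_smul]
  refine Eq.trans ?_ (congrArg _ h3)
  rw [formVal_coeffs, h1, h2, formVal_smul_left, formVal_smul, smul_smul γ,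
    inv_smul_smul₀ (mul_ne_zero hγ (pow_ne_zero _ hc))]
  funext i
  exact map_formVal _ _ _ i

theorem exists_det_macaulayMinor_primitive_ne_zero (hd : 0 < d) {e n : ℕ}
    (hE : e + d = macaulayDeg N d) (ε : Fin n ≃ Mon N (macaulayDeg N d)) :
    ∃ σ : Fin n → Fin (N + 1) × Mon N e,
      (macaulayMinor ε σ (primitive f.coeffPoint)).det ≠ 0 := by
  obtain ⟨γ, hγ, h1⟩ := f.exists_coeffs_eq_smul
  have hform := forms_eq f.isHomogeneous
  have key : ∀ x : Fin (N + 1) → AlgebraicClosure (RatFunc K), (∀ i, MvPolynomial.aeval x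
      (forms (algebraMap K[X] (RatFunc K) ∘ primitive f.coeffPoint) i) = 0) → x = 0 := by
    intro x hx
    refine f.eq_zero_of_aeval x fun i => ?_
    rw [← congrFun hform i]
    change MvPolynomial.aeval x (forms f.coeffs i) = 0
    have h2 : forms f.coeffs i
        = γ • forms (algebraMap K[X] (RatFunc K) ∘ primitive f.coeffPoint) i := by
      rw [h1, forms, forms, Finset.smul_sum]
      refine Finset.sum_congr rfl fun m _ => ?_
      rw [MvPolynomial.smul_monomial]
      rfl
    rw [h2, map_smul, hx, smul_zero]
  obtain ⟨σ, hσ⟩ := exists_det_macaulayMinor_ne_zero hd _ key le_rfl (E := macaulayDeg N d) le_rfl hE ε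
  refine ⟨σ, fun h0 => hσ ?_⟩
  rw [← map_det_macaulayMinor, h0, map_zero]

theorem geomHeight_map_le (x : Projectivization (RatFunc K) (Fin (N + 1) → RatFunc K)) :
    geomHeight (f.map x) ≤ geomHeight f.coeffPoint + d * geomHeight x := by
  obtain ⟨g, hg, h⟩ := f.exists_formVal_primitive x
  refine geomHeight_le fun i => ?_
  have h1 := natDegree_formVal_le (natDegree_primitive_le f.coeffPoint) (natDegree_primitive_le x) i
  rw [h i] at h1
  rcases eq_or_ne (primitive (f.map x) i) 0 with h0 | h0
  · simp [h0]
  · rw [natDegree_mul hg h0] at h1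
    omega

/-- Two losses of at most `(n + 1) * geomHeight f.coeffPoint` occur: one in the Cramer identity, and
one for the common factor `g`, which divides the determinant. -/
theorem mul_geomHeight_le {e n : ℕ} (hE : e + d = macaulayDeg N d)
    (ε : Fin (n + 1) ≃ Mon N (macaulayDeg N d)) {σ : Fin (n + 1) → Fin (N + 1) × Mon N e}
    (hdet : (macaulayMinor ε σ (primitive f.coeffPoint)).det ≠ 0)
    (x : Projectivization (RatFunc K) (Fin (N + 1) → RatFunc K)) :
    d * geomHeight x ≤ geomHeight (f.map x) + 2 * (n + 1) * geomHeight f.coeffPoint := by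
  obtain ⟨g, hg, h⟩ := f.exists_formVal_primitive x
  obtain ⟨i, hi⟩ := exists_natDegree_primitive_eq x
  have hS : (macaulayMinor ε σ (primitive f.coeffPoint)).det.natDegree
      ≤ (n + 1) * geomHeight f.coeffPoint :=
    natDegree_det_le _ (natDegree_macaulayMinor_le ε σ (natDegree_primitive_le f.coeffPoint))
  have hdvd : g ∣ (macaulayMinor ε σ (primitive f.coeffPoint)).det :=
    dvd_det_macaulayMinor hE ε σ _ (span_range_primitive x) fun i => ⟨_, h i⟩
  have hgdeg := natDegree_le_of_dvd hdvd hdet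
  have h2 := mul_natDegree_le hE ε σ (natDegree_primitive_le f.coeffPoint) hdet
    (natDegree_primitive_le x) hi (D' := g.natDegree + geomHeight (f.map x)) fun j => by
      rw [h j]
      exact natDegree_mul_le.trans (add_le_add le_rfl (natDegree_primitive_le _ _))
  nlinarith

end ProjEndo

/-- Tate's telescoping argument. The geometric series gives the error `B / (d - 1)`, which is at
most `B`. -/
theorem exists_tendsto_div_pow {D : ℕ → ℝ} {d B : ℝ} (hd : 2 ≤ d)
    (h : ∀ n, |D (n + 1) - d * D n| ≤ B) :
    ∃ l, Tendsto (fun n => D n / d ^ n) atTop (nhds l) ∧ ∀ n, |D n - d ^ n * l| ≤ B := by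
  have hd0 : 0 < d := by linarith
  have hr : 1 / d < 1 := by
    rw [div_lt_one hd0]
    linarith
  have hu : ∀ n, dist (D n / d ^ n) (D (n + 1) / d ^ (n + 1)) ≤ B / d * (1 / d) ^ n := by
    intro n
    have h1 : D n / d ^ n - D (n + 1) / d ^ (n + 1) = -((D (n + 1) - d * D n) / d ^ (n + 1)) := by
      field_simp
      ring
    rw [Real.dist_eq, h1, abs_neg, abs_div, abs_of_pos (pow_pos hd0 _)]
    refine (div_le_div_of_nonneg_right (h n) (pow_pos hd0 _).le).trans (le_of_eq ?_)
    rw [one_div, inv_pow, pow_succ]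
    field_simp
  obtain ⟨l, hl⟩ := cauchySeq_tendsto_of_complete (cauchySeq_of_le_geometric _ _ hr hu)
  refine ⟨l, hl, fun n => ?_⟩
  have hB : 0 ≤ B := (abs_nonneg _).trans (h 0)
  have h2 := dist_le_of_le_geometric_of_tendsto _ _ hr hu hl n
  have h3 : D n - d ^ n * l = d ^ n * (D n / d ^ n - l) := by
    field_simp
  rw [h3, abs_mul, abs_of_pos (pow_pos hd0 _), ← Real.dist_eq]
  refine (mul_le_mul_of_nonneg_left h2 (pow_pos hd0 _).le).trans ?_
  have h4 : d ^ n * (B / d * (1 / d) ^ n / (1 - 1 / d)) = B / (d - 1) := by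
    have : d - 1 ≠ 0 := by linarith
    rw [one_div, inv_pow]
    field_simp
  rw [h4]
  exact div_le_self hB (by linarith)

namespace ProjEndo

variable {N d : ℕ} {K : Type*} [Field K] (f : ProjEndo (RatFunc K) N d)

/-- The error depends on `f` only, neither on `P` nor on `n`. The existence of the limit behind
`canonicalHeight` is part of the proof. -/
theorem abs_geomHeight_sub_le (hd : 2 ≤ d) {Q : ℕ}
    (hQ : (macaulayDeg N d + 1) ^ (N + 1) ≤ Q)
    (P : Projectivization (RatFunc K) (Fin (N + 1) → RatFunc K)) (n : ℕ) :
    |(geomHeight (f.map^[n] P) : ℝ) - (d : ℝ) ^ n * f.canonicalHeight P|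
      ≤ 2 * Q * geomHeight f.coeffPoint := by
  obtain ⟨e, he⟩ : ∃ e, e + d = macaulayDeg N d := ⟨_, Nat.sub_add_cancel (le_macaulayDeg N d)⟩
  obtain ⟨r, hr⟩ : ∃ r, Fintype.card (Mon N (macaulayDeg N d)) = r + 1 :=
    Nat.exists_eq_succ_of_ne_zero (Fintype.card_pos_iff.2 ⟨purePow N _ 0⟩).ne'
  have hrQ : r + 1 ≤ Q := hr ▸ card_mon_le.trans hQ
  obtain ⟨σ, hσ⟩ := f.exists_det_macaulayMinor_primitive_ne_zero (by omega) he
    (Fintype.equivFinOfCardEq hr).symm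
  have hstep : ∀ n, |(geomHeight (f.map^[n + 1] P) : ℝ) - d * geomHeight (f.map^[n] P)|
      ≤ 2 * Q * geomHeight f.coeffPoint := by
    intro n
    rw [Function.iterate_succ_apply']
    have h1 := f.geomHeight_map_le (f.map^[n] P)
    have h2 := f.mul_geomHeight_le he _ hσ (f.map^[n] P)
    have h3 : 2 * (r + 1) * geomHeight f.coeffPoint ≤ 2 * Q * geomHeight f.coeffPoint := by gcongr
    have h4 : geomHeight f.coeffPoint ≤ 2 * Q * geomHeight f.coeffPoint :=
      Nat.le_mul_of_pos_left _ (by omega)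
    have h5 := h1.trans (Nat.add_le_add_right h4 _)
    have h6 := h2.trans (Nat.add_le_add_left h3 _)
    rw [abs_le]
    constructor
    · have : ((d * geomHeight (f.map^[n] P) : ℕ) : ℝ) ≤ _ := Nat.cast_le.2 h6
      push_cast at this
      linarith
    · have : (geomHeight (f.map (f.map^[n] P)) : ℝ) ≤ _ := Nat.cast_le.2 h5
      push_cast at this
      linarith
  obtain ⟨l, hl, hb⟩ := exists_tendsto_div_pow
    (D := fun n => (geomHeight (f.map^[n] P) : ℝ)) (d := (d : ℝ)) (by exact_mod_cast hd) hstep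
  have : f.canonicalHeight P = l := hl.limUnder_eq
  rw [this]
  exact hb n

/-- A negative value would make `d ^ n * canonicalHeight` unbounded below, at unbounded distance
from degrees, which are nonnegative. -/
theorem canonicalHeight_nonneg (hd : 2 ≤ d)
    (P : Projectivization (RatFunc K) (Fin (N + 1) → RatFunc K)) : 0 ≤ f.canonicalHeight P := by
  by_contra! hlt
  have h := f.abs_geomHeight_sub_le hd le_rfl P
  obtain ⟨n, hn⟩ := pow_unbounded_of_one_lt (2 * ((macaulayDeg N d + 1) ^ (N + 1) : ℕ) *
    (geomHeight f.coeffPoint : ℝ) / (- f.canonicalHeight P)) (y := (d : ℝ))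
    (by exact_mod_cast (by omega : 1 < d))
  rw [div_lt_iff₀ (by linarith)] at hn
  have h1 := (abs_le.1 (h n)).2
  have h2 : (0 : ℝ) ≤ geomHeight (f.map^[n] P) := Nat.cast_nonneg _
  linarith

end ProjEndo

end ProjDyn

namespace ProjDyn

/-! ### Degrees and arithmetic heights of iterates -/

section IterHeight

variable {K : Type*} [Field K] {N d h D : ℕ} {c : Fin (N + 1) × Mon N d → K[X]}
  {v : Fin (N + 1) → K[X]}

/-- Adding `h` turns the recursion `D ↦ h + d * D` into one dominated by multiplication by `d`,
since `2 * h ≤ d * h`. -/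
theorem natDegree_iterate_formVal_le (hd : 2 ≤ d) (hc : ∀ p, (c p).natDegree ≤ h)
    (hv : ∀ i, (v i).natDegree ≤ D) (n : ℕ) (i : Fin (N + 1)) :
    ((formVal c)^[n] v i).natDegree + h ≤ d ^ n * (D + h) := by
  induction n generalizing i with
  | zero => simpa using hv i
  | succ n ih =>
    rw [Function.iterate_succ_apply']
    have hX : h ≤ d ^ n * (D + h) := le_trans (Nat.le_add_left _ _) (ih 0)
    have h1 := natDegree_formVal_le hc (v := (formVal c)^[n] v) (D := d ^ n * (D + h) - h)
      (fun j => by have := ih j; omega) i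
    have h2 : d * (d ^ n * (D + h) - h) + 2 * h ≤ d * (d ^ n * (D + h)) := by
      rw [Nat.mul_sub]
      have h3 : d * h ≤ d * (d ^ n * (D + h)) := Nat.mul_le_mul_left _ hX
      have h4 : 2 * h ≤ d * h := Nat.mul_le_mul_right _ hd
      omega
    rw [pow_succ']
    rw [mul_assoc]
    omega

variable [NumberField K]

theorem polyHeight_monVal_le (hv : ∀ i, (v i).natDegree ≤ D) :
    polyHeight (d * D) (fun m : Mon N d => monVal v m)
      ≤ d * (Real.log (D + 1) + polyHeight D v) := by
  refine le_trans (polyHeight_le_of_natDegree_le (n := d * D)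
    (q := fun I : Fin d → Fin (N + 1) => ∏ a, v (I a)) (fun I => ?_) _ fun m => Or.inr ?_)
    (polyHeight_prod_le v hv d _)
  · refine (natDegree_prod_le _ _).trans
      ((Finset.sum_le_card_nsmul _ _ D fun a _ => hv (I a)).trans ?_)
    simp
  · obtain ⟨I, hI⟩ := exists_monVal_eq_prod (R := K[X]) m
    exact ⟨I, Or.inl (hI v)⟩

theorem polyHeight_formVal_le (hc : ∀ p, (c p).natDegree ≤ h) (hv : ∀ i, (v i).natDegree ≤ D)
    (M : ℕ) : polyHeight M (formVal c v) ≤ Real.log (Fintype.card (Mon N d)) + Real.log (h + 1)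
      + polyHeight h c + d * (Real.log (D + 1) + polyHeight D v) := by
  have h1 := polyHeight_sum_le M fun (i : Fin (N + 1)) (m : Mon N d) => c (i, m) * monVal v m
  have h2 := polyHeight_mul_le (fun m : Mon N d => monVal v m) c (natDegree_monVal_le hv) hc
    (d * D + h)
  have h3 := polyHeight_le_of_natDegree_le (n := d * D + h)
    (p := fun p : Fin (N + 1) × Mon N d => c (p.1, p.2) * monVal v p.2)
    (q := fun r : Mon N d × (Fin (N + 1) × Mon N d) => monVal v r.1 * c r.2)
    (fun r => natDegree_mul_le.trans (add_le_add (natDegree_monVal_le hv _) (hc _))) M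
    fun p => Or.inr ⟨(p.2, p), Or.inl (mul_comm _ _)⟩
  have h4 := polyHeight_monVal_le (d := d) hv
  have h5 : polyHeight M (formVal c v)
      = polyHeight M fun i => ∑ m : Mon N d, c (i, m) * monVal v m := rfl
  linarith

theorem log_pow_mul_add_one_le (d n B : ℕ) (hd : 0 < d) :
    Real.log ((d ^ n * B : ℕ) + 1) ≤ n * d + B := by
  have h1 : ((d ^ n * B : ℕ) + 1 : ℝ) ≤ (d : ℝ) ^ n * (B + 1) := by
    have : (1 : ℝ) ≤ (d : ℝ) ^ n := one_le_pow₀ (by exact_mod_cast hd)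
    push_cast
    linarith
  have hd' : (0 : ℝ) < d := by exact_mod_cast hd
  have h2 := Real.log_le_log (by positivity) h1
  rw [Real.log_mul (by positivity) (by positivity), Real.log_pow] at h2
  have h3 : Real.log d ≤ d := (Real.log_le_sub_one_of_pos hd').trans (by linarith)
  have h4 : Real.log (B + 1) ≤ B := (Real.log_le_sub_one_of_pos (by positivity)).trans (by linarith)
  have h5 : (n : ℝ) * Real.log d ≤ n * d := by gcongr
  linarith

/-- The term `d ^ 2 * n` comes from the logarithm of the degree of the `n`-th iterate, which is
linear in `n`. The induction needs the stronger bound `key`, with the linear correction subtracted.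
-/
theorem le_pow_mul_of_le_mul_add {a : ℕ → ℝ} {d b : ℝ} (hd : 2 ≤ d) (hb : 0 ≤ b)
    (h : ∀ n : ℕ, a (n + 1) ≤ d * a n + b + d ^ 2 * n) (n : ℕ) :
    a n ≤ d ^ n * (a 0 + b + d ^ 2) := by
  have key : ∀ n : ℕ, a n ≤ d ^ n * (a 0 + b + d ^ 2) - (b + d ^ 2) - d ^ 2 * n := by
    intro n
    induction n with
    | zero => simp
    | succ n ih =>
      have h1 : d * a n ≤ d * (d ^ n * (a 0 + b + d ^ 2) - (b + d ^ 2) - d ^ 2 * n) :=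
        mul_le_mul_of_nonneg_left ih (by linarith)
      have h2 := h n
      have h3 : 0 ≤ (d - 2) * (b + d ^ 2 + d ^ 2 * n) := mul_nonneg (by linarith) (by positivity)
      rw [pow_succ']
      push_cast
      nlinarith
  have := key n
  have h1 : 0 ≤ d ^ 2 * (n : ℝ) := by positivity
  nlinarith [sq_nonneg d]

theorem polyHeight_iterate_formVal_le (hd : 2 ≤ d) (hc : ∀ p, (c p).natDegree ≤ h)
    (hv : ∀ i, (v i).natDegree ≤ D) (n : ℕ) :
    polyHeight (d ^ n * (D + h)) ((formVal c)^[n] v) ≤ d ^ n * (polyHeight D v +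
      (Real.log (Fintype.card (Mon N d)) + Real.log (h + 1) + polyHeight h c + d * (D + h)) + d ^ 2)
    := by
  have hdeg := fun n i => (Nat.le_add_right _ h).trans (natDegree_iterate_formVal_le hd hc hv n i)
  have hlog1 : 0 ≤ Real.log (Fintype.card (Mon N d)) := Real.log_natCast_nonneg _
  have hlog2 : 0 ≤ Real.log ((h : ℝ) + 1) := by
    exact_mod_cast Real.log_natCast_nonneg (h + 1)
  have hη := polyHeight_nonneg h c
  refine (le_pow_mul_of_le_mul_add (a := fun n => polyHeight (d ^ n * (D + h)) ((formVal c)^[n] v))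
    (d := d) (by exact_mod_cast hd)
    (b := Real.log (Fintype.card (Mon N d)) + Real.log (h + 1) + polyHeight h c + d * (D + h))
    (by positivity) (fun n => ?_) n).trans ?_
  · have h1 := polyHeight_formVal_le hc (hdeg n) (d ^ (n + 1) * (D + h))
    have h2 := log_pow_mul_add_one_le d n (D + h) (by omega)
    have h3 : (d : ℝ) * Real.log ((d ^ n * (D + h) : ℕ) + 1) ≤ d * (n * d + (D + h : ℕ)) := by
      gcongr
    simp only [Function.iterate_succ_apply']
    push_cast at h1 h3 ⊢
    linarith
  · gcongr
    exact polyHeight_le_of_natDegree_le hv _ fun j => Or.inr ⟨j, Or.inl rfl⟩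

end IterHeight

namespace ProjEndo

variable {N d : ℕ} {K : Type*} [Field K] (f : ProjEndo (RatFunc K) N d)

theorem exists_iterate_formVal_eq (P : Projectivization (RatFunc K) (Fin (N + 1) → RatFunc K))
    (n : ℕ) : ∃ G : K[X], G ≠ 0 ∧ (formVal (primitive f.coeffPoint))^[n] (primitive P)
      = G • primitive (f.map^[n] P) := by
  induction n with
  | zero => exact ⟨1, one_ne_zero, (one_smul _ _).symm⟩
  | succ n ih =>
    obtain ⟨G, hG, h⟩ := ih
    obtain ⟨g, hg, h1⟩ := f.exists_formVal_primitive (f.map^[n] P)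
    refine ⟨G ^ d * g, mul_ne_zero (pow_ne_zero _ hG) hg, ?_⟩
    rw [Function.iterate_succ_apply', Function.iterate_succ_apply', h, formVal_smul, mul_smul]
    congr 1
    exact funext h1

/-- The iterate of the coordinate tuple may acquire a common factor `G`. Gelfond's inequality
removes it at the cost of twice the degree, which is again of order `d ^ n`. -/
theorem polyHeight_primitive_iterate_le [NumberField K] (hd : 2 ≤ d)
    (P : Projectivization (RatFunc K) (Fin (N + 1) → RatFunc K)) (n : ℕ) :
    polyHeight (geomHeight (f.map^[n] P)) (primitive (f.map^[n] P))
      ≤ d ^ n * ((Fintype.card (Mon N d) + d ^ 2 + d + 3)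
        * (ProjDyn.totalHeight P + f.totalHeight + 1)) := by
  obtain ⟨G, hG, h⟩ := f.exists_iterate_formVal_eq P n
  have hc := natDegree_primitive_le f.coeffPoint
  have hv := natDegree_primitive_le P
  have h1 := polyHeight_iterate_formVal_le hd hc hv n
  have hdeg := fun i => (Nat.le_add_right _ _).trans (natDegree_iterate_formVal_le hd hc hv n i)
  have h2 := polyHeight_le_of_mul_eq hG (x := primitive (f.map^[n] P)) (fun i => by
    rw [h, Pi.smul_apply, smul_eq_mul, mul_comm]) hdeg
  have hx : ∀ i, (primitive (f.map^[n] P) i).natDegree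
      ≤ d ^ n * (geomHeight P + geomHeight f.coeffPoint) := by
    intro i
    have := hdeg i
    rw [h, Pi.smul_apply, smul_eq_mul] at this
    rcases eq_or_ne (primitive (f.map^[n] P) i) 0 with h0 | h0
    · simp [h0]
    · rw [natDegree_mul hG h0] at this
      omega
  have h3 := polyHeight_le_of_natDegree_le hx
    (geomHeight (f.map^[n] P)) fun j => Or.inr ⟨j, Or.inl rfl⟩
  have hP : ProjDyn.totalHeight P = polyHeight (geomHeight P) (primitive P) + geomHeight P := rfl
  have hf : f.totalHeight = polyHeight (geomHeight f.coeffPoint) (primitive f.coeffPoint)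
    + geomHeight f.coeffPoint := rfl
  have hP0 := polyHeight_nonneg (geomHeight P) (primitive P)
  have hf0 := polyHeight_nonneg (geomHeight f.coeffPoint) (primitive f.coeffPoint)
  have hl1 : Real.log (Fintype.card (Mon N d)) ≤ Fintype.card (Mon N d) := by
    rcases Nat.eq_zero_or_pos (Fintype.card (Mon N d)) with h0 | h0
    · simp [h0]
    · exact (Real.log_le_sub_one_of_pos (by exact_mod_cast h0)).trans (by linarith)
  have hl2 : Real.log ((geomHeight f.coeffPoint : ℝ) + 1) ≤ geomHeight f.coeffPoint :=
    (Real.log_le_sub_one_of_pos (by positivity)).trans (by linarith)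
  refine h3.trans (h2.trans ?_)
  push_cast
  have h4 : (d : ℝ) ^ n * (polyHeight (geomHeight P) (primitive P) +
      (Real.log (Fintype.card (Mon N d)) + Real.log ((geomHeight f.coeffPoint : ℝ) + 1)
        + polyHeight (geomHeight f.coeffPoint) (primitive f.coeffPoint)
        + d * (geomHeight P + geomHeight f.coeffPoint)) + d ^ 2
      + 2 * (geomHeight P + geomHeight f.coeffPoint)) ≤ d ^ n * ((Fintype.card (Mon N d) + d ^ 2 + d + 3)
        * (ProjDyn.totalHeight P + f.totalHeight + 1)) := by
    refine mul_le_mul_of_nonneg_left ?_ (by positivity)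
    rw [hP, hf]
    have hA : (0 : ℝ) ≤ Fintype.card (Mon N d) := Nat.cast_nonneg _
    have hB : (0 : ℝ) ≤ geomHeight P := Nat.cast_nonneg _
    have hC : (0 : ℝ) ≤ geomHeight f.coeffPoint := Nat.cast_nonneg _
    have hD : (0 : ℝ) ≤ d := Nat.cast_nonneg _
    generalize polyHeight (geomHeight P) (primitive P) = a at *
    generalize polyHeight (geomHeight f.coeffPoint) (primitive f.coeffPoint) = b at *
    generalize (geomHeight P : ℝ) = u at *
    generalize (geomHeight f.coeffPoint : ℝ) = w at *
    generalize (Fintype.card (Mon N d) : ℝ) = r at *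
    have e1 : 0 ≤ (r + d ^ 2) * (a + u + (b + w)) := by positivity
    have e2 : 0 ≤ d * (a + b) := by positivity
    nlinarith
  linarith

end ProjEndo

end ProjDyn

namespace ProjDyn

/-! ### Orbits over a number field -/

section Orbit

variable {L : Type*} [Field L] {N d : ℕ}

theorem exists_iterate_formVal_smul (c : Fin (N + 1) × Mon N d → L) {a b : L} (ha : a ≠ 0)
    (hb : b ≠ 0) (v : Fin (N + 1) → L) (n : ℕ) :
    ∃ r : L, r ≠ 0 ∧ (formVal (a • c))^[n] (b • v) = r • (formVal c)^[n] v := by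
  induction n with
  | zero => exact ⟨b, hb, rfl⟩
  | succ n ih =>
    obtain ⟨r, hr, h⟩ := ih
    refine ⟨a * r ^ d, mul_ne_zero ha (pow_ne_zero _ hr), ?_⟩
    rw [Function.iterate_succ_apply', Function.iterate_succ_apply', h, formVal_smul,
      formVal_smul_left, smul_smul, mul_comm]

theorem exists_iterate_add_formVal_eq_smul (c : Fin (N + 1) × Mon N d → L)
    {v : Fin (N + 1) → L} {m n : ℕ}
    (h : ∃ b : L, b ≠ 0 ∧ (formVal c)^[m] v = b • (formVal c)^[n] v) (k : ℕ) :
    ∃ b : L, b ≠ 0 ∧ (formVal c)^[m + k] v = b • (formVal c)^[n + k] v := by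
  obtain ⟨b, hb, h⟩ := h
  obtain ⟨r, hr, h1⟩ := exists_iterate_formVal_smul c one_ne_zero hb ((formVal c)^[n] v) k
  refine ⟨r, hr, ?_⟩
  rw [one_smul] at h1
  rw [add_comm m, add_comm n, Function.iterate_add_apply, Function.iterate_add_apply, h, h1]

variable {e E r : ℕ} {c : Fin (N + 1) × Mon N d → L}

theorem formVal_ne_zero (hE : e + d = E) (ε : Fin r ≃ Mon N E)
    {σ : Fin r → Fin (N + 1) × Mon N e} (hdet : (macaulayMinor ε σ c).det ≠ 0)
    {v : Fin (N + 1) → L} (hv : v ≠ 0) : formVal c v ≠ 0 := by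
  intro h
  refine hv (funext fun i => ?_)
  have h1 := det_macaulayMinor_mul_pow hE ε σ c v i
  rw [h] at h1
  simp only [Pi.zero_apply, mul_zero, zero_mul, Finset.sum_const_zero] at h1
  exact eq_zero_of_pow_eq_zero ((mul_eq_zero.1 h1).resolve_left hdet)

variable [NumberField L]

/-- If `h(w) > B`, then `h(f(w)) ≥ 2 * h(w) - B > h(w)`, so from there on the heights increase
strictly, whereas two iterates agree up to a scalar. -/
theorem absHeight_iterate_le_of_preperiodic {B : ℝ} (hd : 2 ≤ d)
    (hB : ∀ v, d * absHeight v ≤ B + absHeight (formVal c v)) {v : Fin (N + 1) → L} {m n : ℕ}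
    (hmn : m < n) (h : ∃ b : L, b ≠ 0 ∧ (formVal c)^[m] v = b • (formVal c)^[n] v) (k : ℕ) :
    absHeight ((formVal c)^[k] v) ≤ B := by
  by_contra! hk
  have hstep : ∀ w : Fin (N + 1) → L, B < absHeight w → absHeight w < absHeight (formVal c w) := by
    intro w hw
    have h1 := hB w
    have h2 : (2 : ℝ) * absHeight w ≤ d * absHeight w :=
      mul_le_mul_of_nonneg_right (by exact_mod_cast hd) (absHeight_nonneg w)
    linarith
  have hall : ∀ j, B < absHeight ((formVal c)^[j + k] v) := by
    intro j
    induction j with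
    | zero => simpa using hk
    | succ j ih =>
      rw [add_right_comm, Function.iterate_succ_apply']
      exact ih.trans (hstep _ ih)
  have hmono : StrictMono fun j => absHeight ((formVal c)^[j + k] v) := by
    refine strictMono_nat_of_lt_succ fun j => ?_
    rw [add_right_comm, Function.iterate_succ_apply']
    exact hstep _ (hall j)
  obtain ⟨b, hb, h1⟩ := exists_iterate_add_formVal_eq_smul c h k
  refine (hmono hmn).ne ?_
  simp only [h1, absHeight_smul _ hb]

end Orbit

/-! ### Specialization at a finite point of the line -/

section Specialization

variable {K L : Type*} [Field K] [Field L] [Algebra K L] {ι : Type*} [Fintype ι]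

theorem specializeVec_eq_smul (x : Projectivization (RatFunc K) (ι → RatFunc K)) {s : Fin 2 → L}
    (hs : s 1 ≠ 0) : specializeVec x s
      = s 1 ^ geomHeight x • fun i => ((primitive x i).map (algebraMap K L)).eval (s 0 / s 1) := by
  funext i
  rw [Pi.smul_apply, smul_eq_mul, eval_map, eval₂_eq_sum_range'
    _ (Nat.lt_succ_of_le (natDegree_primitive_le x i)), specializeVec, Finset.mul_sum]
  refine Finset.sum_congr rfl fun j hj => ?_
  have hj' : j ≤ geomHeight x := Nat.lt_succ_iff.1 (Finset.mem_range.1 hj)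
  have h1 : s 1 ^ geomHeight x = s 1 ^ (geomHeight x - j) * s 1 ^ j := by
    rw [← pow_add, Nat.sub_add_cancel hj']
  rw [h1, div_pow]
  field_simp

theorem exists_specialize_rep_eq_smul (x : Projectivization (RatFunc K) (ι → RatFunc K))
    (t : Projectivization L (Fin 2 → L)) (hs : t.rep 1 ≠ 0) :
    ∃ u : L, u ≠ 0 ∧ (specialize x t).rep
      = u • fun i => ((primitive x i).map (algebraMap K L)).eval (t.rep 0 / t.rep 1) := by
  obtain ⟨b, hb⟩ := Projectivization.exists_smul_eq_mk_rep L (specializeVec x t.rep)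
    (specializeVec_ne_zero x t.rep t.rep_nonzero)
  refine ⟨b * t.rep 1 ^ geomHeight x, mul_ne_zero b.ne_zero (pow_ne_zero _ hs), ?_⟩
  rw [mul_smul, ← specializeVec_eq_smul x hs]
  exact hb.symm

theorem absHeight_rep_eq [NumberField L] (t : Projectivization L (Fin 2 → L)) (hs : t.rep 1 ≠ 0) :
    absHeight t.rep = absHeight ![t.rep 0 / t.rep 1, 1] := by
  rw [← absHeight_smul ![t.rep 0 / t.rep 1, 1] hs]
  congr 1
  funext i
  fin_cases i
  · simp [mul_div_cancel₀ _ hs]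
  · simp

theorem absHeight_eq_zero_of_apply_one_eq_zero [NumberField L] {s : Fin 2 → L} (hs : s 1 = 0) :
    absHeight s = 0 := by
  refine le_antisymm ?_ (absHeight_nonneg _)
  refine le_trans (absHeight_le_of_forall_eq (z := fun _ : Unit => s 0) fun j => ?_)
    (absHeight_eq_zero_of_subsingleton _).le
  fin_cases j
  · exact Or.inr ⟨(), Or.inl rfl⟩
  · exact Or.inl hs

variable {N d : ℕ}

/-- The values of a tuple of polynomials at a point of an extension field. -/
noncomputable def evalAt {ι : Type*} (q : ι → K[X]) (a : L) : ι → L :=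
  fun i => ((q i).map (algebraMap K L)).eval a

theorem evalAt_eq_comp {ι : Type*} (q : ι → K[X]) (a : L) :
    evalAt q a = ((evalRingHom a).comp (mapRingHom (algebraMap K L))) ∘ q := rfl

theorem iterate_formVal_evalAt (c : Fin (N + 1) × Mon N d → K[X]) (p : Fin (N + 1) → K[X]) (a : L)
    (n : ℕ) : (formVal (evalAt c a))^[n] (evalAt p a) = evalAt ((formVal c)^[n] p) a := by
  induction n with
  | zero => rfl
  | succ n ih =>
    rw [Function.iterate_succ_apply', Function.iterate_succ_apply', ih]
    funext i
    exact (map_formVal ((evalRingHom a).comp (mapRingHom (algebraMap K L))) c _ i).symm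

theorem evalForms_formsOf (c : Fin (N + 1) × Mon N d → L) : evalForms (formsOf c) = formVal c := by
  funext v i
  exact eval_forms c v i

/-- The chosen representatives of `f_t` and `P_t` differ from the evaluated coprime tuples by
nonzero scalars, and by homogeneity so do all iterates. -/
theorem ProjEndo.exists_iterate_eq_of_isPreperiodic (f : ProjEndo (RatFunc K) N d)
    (P : Projectivization (RatFunc K) (Fin (N + 1) → RatFunc K))
    (t : Projectivization L (Fin 2 → L)) (hs : t.rep 1 ≠ 0)
    (h : IsPreperiodic (f.specialize t) (ProjDyn.specialize P t)) :
    ∃ m n, m < n ∧ (formVal (evalAt (primitive f.coeffPoint) (t.rep 0 / t.rep 1)))^[m]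
        (evalAt (primitive P) (t.rep 0 / t.rep 1)) ≠ 0 ∧
      ∃ b : L, b ≠ 0 ∧ (formVal (evalAt (primitive f.coeffPoint) (t.rep 0 / t.rep 1)))^[m]
        (evalAt (primitive P) (t.rep 0 / t.rep 1))
        = b • (formVal (evalAt (primitive f.coeffPoint) (t.rep 0 / t.rep 1)))^[n]
        (evalAt (primitive P) (t.rep 0 / t.rep 1)) := by
  obtain ⟨m, n, hmn, hm, hn, heq⟩ := h
  obtain ⟨u, hu, hu'⟩ := exists_specialize_rep_eq_smul f.coeffPoint t hs
  obtain ⟨w, hw, hw'⟩ := exists_specialize_rep_eq_smul P t hs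
  have key : ∀ k, ∃ r : L, r ≠ 0 ∧
      (evalForms (f.specialize t))^[k] (ProjDyn.specialize P t).rep
      = r • (formVal (evalAt (primitive f.coeffPoint) (t.rep 0 / t.rep 1)))^[k]
        (evalAt (primitive P) (t.rep 0 / t.rep 1)) := by
    intro k
    rw [ProjEndo.specialize, evalForms_formsOf, hu', hw']
    exact exists_iterate_formVal_smul _ hu hw _ k
  obtain ⟨r, hr, hr'⟩ := key m
  obtain ⟨r', hr0, hr''⟩ := key n
  obtain ⟨a, ha⟩ := (Projectivization.mk_eq_mk_iff L _ _ hm hn).1 heq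
  refine ⟨m, n, hmn, fun h0 => hm (by rw [hr', h0, smul_zero]), r⁻¹ * (a * r'),
    mul_ne_zero (inv_ne_zero hr) (mul_ne_zero a.ne_zero hr0), ?_⟩
  rw [mul_smul, mul_smul, ← hr'', eq_inv_smul_iff₀ hr, ← hr']
  exact ha.symm

variable [NumberField K] [NumberField L]

theorem absHeight_evalAt_le {ι : Type*} [Finite ι] {n : ℕ} (q : ι → K[X])
    (hq : ∀ i, (q i).natDegree ≤ n) (a : L) :
    absHeight (evalAt q a) ≤ Real.log (n + 1) + polyHeight n q + n * absHeight ![a, 1] := by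
  rw [← polyHeight_map (L := L)]
  exact absHeight_eval_le _ (fun i => natDegree_map_le.trans (hq i)) a

/-- `natDegree_mul_absHeight_le` with `m + 1 = geomHeight x` and the logarithms estimated crudely.
The Bézout relation behind coprimality persists over `L`. -/
theorem mul_absHeight_le_evalAt {ι : Type*} [Fintype ι] [Nonempty ι]
    (x : Projectivization (RatFunc K) (ι → RatFunc K)) (a : L) :
    (geomHeight x : ℝ) * absHeight ![a, 1] ≤ 2 * geomHeight x + 4 * (geomHeight x : ℝ) ^ 2
      + 2 * geomHeight x * polyHeight (geomHeight x) (primitive x)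
      + absHeight (evalAt (primitive x) a) := by
  obtain ⟨i, hi⟩ := exists_natDegree_primitive_eq x
  rcases Nat.eq_zero_or_pos (geomHeight x) with h0 | h0
  · simp [h0, absHeight_nonneg]
  obtain ⟨m, hm⟩ := Nat.exists_eq_succ_of_ne_zero h0.ne'
  have hspan : Ideal.span (Set.range fun i => (primitive x i).map (algebraMap K L)) = ⊤ := by
    have := congrArg (Ideal.map (mapRingHom (algebraMap K L))) (span_range_primitive x)
    rw [Ideal.map_span, Ideal.map_top, ← Set.range_comp] at this
    exact this
  have h1 := natDegree_mul_absHeight_le hspan (m := m)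
    (fun j => natDegree_map_le.trans ((natDegree_primitive_le x j).trans hm.le)) (i₀ := i)
    (by rw [natDegree_map, hi, hm]) a
  rw [polyHeight_map] at h1
  have hlog1 : Real.log (2 * m + 2) ≤ 2 * m + 2 :=
    (Real.log_le_sub_one_of_pos (by positivity)).trans (by linarith)
  have hlog2 : Real.log ((2 * m + 1).factorial) ≤ (2 * m + 2) ^ 2 := by
    have h2 : Real.log ((2 * m + 1).factorial) ≤ Real.log (((2 * m + 1) ^ (2 * m + 1) : ℕ)) :=
      Real.log_le_log (by exact_mod_cast Nat.factorial_pos _)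
        (by exact_mod_cast Nat.factorial_le_pow _)
    rw [Nat.cast_pow, Real.log_pow] at h2
    have h3 : Real.log ((2 * m + 1 : ℕ) : ℝ) ≤ ((2 * m + 1 : ℕ) : ℝ) :=
      (Real.log_le_sub_one_of_pos (by positivity)).trans (by linarith)
    have h4 : ((2 * m + 1 : ℕ) : ℝ) * Real.log ((2 * m + 1 : ℕ) : ℝ)
      ≤ ((2 * m + 1 : ℕ) : ℝ) * ((2 * m + 1 : ℕ) : ℝ) := by gcongr
    refine h2.trans (h4.trans ?_)
    push_cast
    nlinarith [Nat.cast_nonneg (α := ℝ) m]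
  have hH := polyHeight_nonneg (m + 1) (primitive x)
  have e1 : absHeight (fun i => ((primitive x i).map (algebraMap K L)).eval a)
    = absHeight (evalAt (primitive x) a) := rfl
  rw [e1] at h1
  rw [hm, Nat.succ_eq_add_one]
  push_cast
  linarith

end Specialization

end ProjDyn

/-! ### The explicit constant and the final estimate -/

namespace ProjDyn

/-- A bound for the sizes of the Macaulay matrices. -/
def macaulayBound (d N : ℕ) : ℕ := (macaulayDeg N d + 2) ^ (N + 2)

theorem computable_macaulayBound : Computable₂ macaulayBound := by
  have hpow : Primrec₂ ((· ^ ·) : ℕ → ℕ → ℕ) := Primrec₂.unpaired'.1 Nat.Primrec.pow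
  have hN : Primrec fun p : ℕ × ℕ => p.2 + 1 := Primrec.succ.comp Primrec.snd
  have h1 : Primrec fun p : ℕ × ℕ => (p.2 + 1) * p.1 + 1 :=
    Primrec.succ.comp (Primrec.nat_mul.comp hN Primrec.fst)
  have h2 : Primrec fun p : ℕ × ℕ => macaulayDeg p.2 p.1 :=
    Primrec.nat_mul.comp hN (hpow.comp h1 hN)
  have h3 : Primrec fun p : ℕ × ℕ => (macaulayDeg p.2 p.1 + 2) ^ (p.2 + 2) :=
    hpow.comp (Primrec.succ.comp (Primrec.succ.comp h2)) (Primrec.succ.comp hN)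
  exact h3.to_comp

theorem computable_const_mul_macaulayBound_pow :
    Computable₂ fun d N => 72 * macaulayBound d N ^ 3 := by
  have hpow : Primrec₂ ((· ^ ·) : ℕ → ℕ → ℕ) := Primrec₂.unpaired'.1 Nat.Primrec.pow
  exact (Primrec.nat_mul.to_comp).comp (Computable.const 72)
    (hpow.to_comp.comp computable_macaulayBound (Computable.const 3))

/-- The shifts by two in `macaulayBound` leave room for this constant, which governs the arithmetic
heights of iterates, next to the size of the Macaulay matrix. -/
theorem card_mon_add_le {N d : ℕ} (hd : 1 ≤ d) :
    Fintype.card (Mon N d) + d ^ 2 + d + 3 ≤ macaulayBound d N := by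
  have h1 : Fintype.card (Mon N d) ≤ (d + 2) ^ (N + 1) :=
    card_mon_le.trans (Nat.pow_le_pow_left (by omega) _)
  have h2 : d + 2 ≤ (d + 2) ^ (N + 1) := Nat.le_self_pow (by omega) _
  have h3 : (d + 2) ^ (N + 2) ≤ macaulayBound d N :=
    Nat.pow_le_pow_left (Nat.add_le_add_right (le_macaulayDeg N d) 2) _
  rw [pow_succ] at h3
  nlinarith

theorem pow_le_macaulayBound (d N : ℕ) : (macaulayDeg N d + 1) ^ (N + 1) ≤ macaulayBound d N :=
  (Nat.pow_le_pow_left (by omega) _).trans (Nat.pow_le_pow_right (by omega) (by omega))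

theorem log_factorial_le (n : ℕ) : Real.log n.factorial ≤ (n : ℝ) ^ 2 := by
  have h2 : Real.log n.factorial ≤ Real.log ((n ^ n : ℕ)) :=
    Real.log_le_log (by exact_mod_cast Nat.factorial_pos _) (by exact_mod_cast Nat.factorial_le_pow _)
  rw [Nat.cast_pow, Real.log_pow] at h2
  have h3 : Real.log n ≤ n := by
    rcases Nat.eq_zero_or_pos n with rfl | hn
    · simp
    · exact (Real.log_le_sub_one_of_pos (by exact_mod_cast hn)).trans (by linarith)
  have h4 : (n : ℝ) * Real.log n ≤ n * n := by gcongr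
  nlinarith

/-- The least admissible `n` is used. If `n = 0`, then `hηQ` suffices; otherwise minimality gives `d
^ n * η < d * 4 * Q * T`, so `(d ^ n * H) ^ 2` is at most `16 * Q ^ 3 * T ^ 2 * H ^ 2 / η ^ 2`. The
constant is `72 = 4 * 16 + 8`, where `8` comes from `Q + T ≤ 2 * Q * T` and `η ^ 2 ≤ 4 * Q ^ 2 * H ^
2`. -/
theorem le_of_forall_pow_bound {Q T H η x d : ℝ} (hd : 2 ≤ d) (hdQ : d ^ 2 ≤ Q) (hT : 1 ≤ T)
    (hTH : T ≤ H) (hη : 0 < η) (hηQ : η ≤ 2 * Q * H) (hx : 0 ≤ x)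
    (key : ∀ n : ℕ, 4 * Q * T ≤ d ^ n * η → T * x ≤ 4 * (d ^ n * H) ^ 2 + Q + T) :
    x ≤ 72 * Q ^ 3 * (H ^ 4 / η ^ 2) := by
  have hQ : 4 ≤ Q := by nlinarith
  have hH : 1 ≤ H := hT.trans hTH
  have hH2 : H ≤ H ^ 2 := by nlinarith
  have hH4 : H ^ 2 ≤ H ^ 4 := by nlinarith [sq_nonneg (H ^ 2)]
  have hη2 : η ^ 2 ≤ 4 * Q ^ 2 * H ^ 2 := by
    calc η ^ 2 ≤ (2 * Q * H) ^ 2 := by gcongr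
      _ = 4 * Q ^ 2 * H ^ 2 := by ring
  suffices x * η ^ 2 ≤ 72 * Q ^ 3 * H ^ 4 by
    rw [← mul_div_assoc, le_div_iff₀ (by positivity)]
    exact this
  have hex : ∃ n : ℕ, 4 * Q * T ≤ d ^ n * η := by
    obtain ⟨n, hn⟩ := pow_unbounded_of_one_lt (4 * Q * T / η) (y := d) (by linarith)
    rw [div_lt_iff₀ hη] at hn
    exact ⟨n, hn.le⟩
  classical
  have hfind := key _ (Nat.find_spec hex)
  rcases hn : Nat.find hex with _ | n
  · rw [hn, pow_zero, one_mul] at hfind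
    have h1 : x ≤ T * x := le_mul_of_one_le_left hx hT
    have h2 : x ≤ 3 * Q * H ^ 2 := by nlinarith
    calc x * η ^ 2 ≤ 3 * Q * H ^ 2 * (4 * Q ^ 2 * H ^ 2) := by gcongr
      _ = 12 * (Q ^ 3 * H ^ 4) := by ring
      _ ≤ 72 * Q ^ 3 * H ^ 4 := by
        have : 0 ≤ Q ^ 3 * H ^ 4 := by positivity
        linarith
  · rw [hn] at hfind
    have h1 : d ^ n * η < 4 * Q * T := not_le.1 (Nat.find_min hex (by omega))
    have h2 : (d ^ (n + 1) * η) ^ 2 ≤ 16 * Q ^ 3 * T ^ 2 := by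
      calc (d ^ (n + 1) * η) ^ 2 = d ^ 2 * (d ^ n * η) ^ 2 := by ring
        _ ≤ Q * (4 * Q * T) ^ 2 := by gcongr
        _ = 16 * Q ^ 3 * T ^ 2 := by ring
    have h3 : T * (x * η ^ 2) ≤ T * (72 * Q ^ 3 * H ^ 4) := by
      calc T * (x * η ^ 2) = T * x * η ^ 2 := by ring
        _ ≤ (4 * (d ^ (n + 1) * H) ^ 2 + Q + T) * η ^ 2 := by gcongr
        _ = 4 * (d ^ (n + 1) * η) ^ 2 * H ^ 2 + (Q + T) * η ^ 2 := by ring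
        _ ≤ 4 * (16 * Q ^ 3 * T ^ 2) * H ^ 2 + 2 * Q * T * (4 * Q ^ 2 * H ^ 2) := by
          gcongr
          nlinarith
        _ = T * (64 * Q ^ 3 * (T * H ^ 2) + 8 * Q ^ 3 * H ^ 2) := by ring
        _ ≤ T * (64 * Q ^ 3 * H ^ 4 + 8 * Q ^ 3 * H ^ 4) := by
          have : T * H ^ 2 ≤ H ^ 4 := by
            calc T * H ^ 2 ≤ H ^ 2 * H ^ 2 := by gcongr; linarith
              _ = H ^ 4 := by ring
          gcongr
        _ = T * (72 * Q ^ 3 * H ^ 4) := by ring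
    exact le_of_mul_le_mul_left h3 (by linarith)

/-- Since `D ≥ 2 * Q * T`, the term `Q * T * x` in the bound for `z` uses up at most half of `D *
x`; what remains is divided by `Q`. -/
theorem mul_le_of_orbit_bound {Q T x D p W z : ℝ} (hQ : 4 ≤ Q)
    (hD : 4 * Q * T - 2 * Q * T ≤ D) (hx : 0 ≤ x) (hD0 : 0 ≤ D) (hp : 0 ≤ p) (hW : 1 ≤ W)
    (hDW : D ≤ W) (hpW : p ≤ Q * W) (h : D * x ≤ 2 * D + 4 * D ^ 2 + 2 * D * p + z)
    (hz : z ≤ Q ^ 2 + Q * (T * (1 + x))) : T * x ≤ 4 * W ^ 2 + Q + T := by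
  have e1 : D ^ 2 ≤ W ^ 2 := by gcongr
  have e2 : 2 * D * p ≤ 2 * W * (Q * W) := by gcongr
  have e3 : 2 * Q * T * x ≤ D * x := mul_le_mul_of_nonneg_right (by linarith) hx
  have e4 : W ≤ W ^ 2 := le_self_pow₀ hW two_ne_zero
  have e5 : 4 * W ^ 2 ≤ Q * W ^ 2 := by gcongr
  have e6 : Q * (T * x) ≤ Q * (4 * W ^ 2 + Q + T) := by linarith
  exact le_of_mul_le_mul_left e6 (by linarith)

namespace ProjEndo

variable {N d : ℕ} {K : Type*} [Field K] (f : ProjEndo (RatFunc K) N d)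

theorem geomHeight_iterate_add_le (hd : 2 ≤ d)
    (P : Projectivization (RatFunc K) (Fin (N + 1) → RatFunc K)) (n : ℕ) :
    geomHeight (f.map^[n] P) + geomHeight f.coeffPoint
      ≤ d ^ n * (geomHeight P + geomHeight f.coeffPoint) := by
  induction n with
  | zero => simp
  | succ n ih =>
    rw [Function.iterate_succ_apply', pow_succ', mul_assoc]
    have h1 := f.geomHeight_map_le (f.map^[n] P)
    have h2 := Nat.mul_le_mul_left d ih
    have h3 := Nat.mul_le_mul_right (geomHeight f.coeffPoint) hd
    rw [mul_add] at h2
    omega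

variable [NumberField K] {L : Type*} [Field L] [NumberField L] [Algebra K L]

theorem one_le_totalHeight_add_one : 1 ≤ f.totalHeight + 1 := by
  have h1 : 0 ≤ arithHeight f.coeffPoint := absHeight_nonneg _
  have h2 : f.totalHeight = arithHeight f.coeffPoint + geomHeight f.coeffPoint := rfl
  have h3 : (0 : ℝ) ≤ geomHeight f.coeffPoint := Nat.cast_nonneg _
  linarith

/-- The case of bad reduction: `a` is a root of the determinant, a nonzero polynomial of degree at
most `r * geomHeight f.coeffPoint` whose height is bounded by the determinant expansion. -/
theorem absHeight_le_of_det_eq_zero {e E r : ℕ} {Q : ℝ} (ε : Fin r ≃ Mon N E)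
    {σ : Fin r → Fin (N + 1) × Mon N e}
    (hdet : (macaulayMinor ε σ (primitive f.coeffPoint)).det ≠ 0) (hr : (r : ℝ) ≤ Q) (hQ : 1 ≤ Q)
    {a : L} (ha : (macaulayMinor ε σ (evalAt (primitive f.coeffPoint) a)).det = 0) :
    absHeight ![a, 1] ≤ 4 * Q ^ 2 * (f.totalHeight + 1) := by
  have hc := natDegree_primitive_le f.coeffPoint
  have hdeg := natDegree_det_le _ (natDegree_macaulayMinor_le ε σ hc)
  have h0 : ((macaulayMinor ε σ (primitive f.coeffPoint)).det.map (algebraMap K L)).eval a = 0 := by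
    rw [evalAt_eq_comp, ← map_det_macaulayMinor] at ha
    exact ha
  have h1 := absHeight_root_le (Polynomial.map_ne_zero hdet) (natDegree_map_le.trans hdeg) h0
  rw [polyHeight_map _ fun _ : Unit => (macaulayMinor ε σ (primitive f.coeffPoint)).det] at h1
  have h2 := polyHeight_det_le (N := r * geomHeight f.coeffPoint)
    (macaulayMinor ε σ (primitive f.coeffPoint)) _ hc (macaulayMinor_eq_zero_or ε σ _)
  have h3 := log_factorial_le r
  have hT : f.totalHeight = polyHeight (geomHeight f.coeffPoint) (primitive f.coeffPoint)
    + geomHeight f.coeffPoint := rfl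
  have hl : Real.log ((geomHeight f.coeffPoint : ℝ) + 1) ≤ geomHeight f.coeffPoint :=
    (Real.log_le_sub_one_of_pos (by positivity)).trans (by linarith)
  have hη := polyHeight_nonneg (geomHeight f.coeffPoint) (primitive f.coeffPoint)
  have hr0 : (0 : ℝ) ≤ r := Nat.cast_nonneg _
  have hg : (0 : ℝ) ≤ geomHeight f.coeffPoint := Nat.cast_nonneg _
  have h4 : (r : ℝ) * (Real.log (geomHeight f.coeffPoint + 1)
      + polyHeight (geomHeight f.coeffPoint) (primitive f.coeffPoint)) ≤ Q * f.totalHeight := by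
    have : Real.log (geomHeight f.coeffPoint + 1)
      + polyHeight (geomHeight f.coeffPoint) (primitive f.coeffPoint) ≤ f.totalHeight := by linarith
    have h0 : 0 ≤ f.totalHeight := by linarith
    exact (mul_le_mul_of_nonneg_left this hr0).trans (mul_le_mul_of_nonneg_right hr h0)
  have h5 : (r : ℝ) * geomHeight f.coeffPoint ≤ Q * f.totalHeight :=
    mul_le_mul hr (by linarith) hg (by linarith)
  have h6 : (r : ℝ) ^ 2 ≤ Q ^ 2 := by gcongr
  have h7 : Q * f.totalHeight ≤ Q ^ 2 * f.totalHeight :=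
    mul_le_mul_of_nonneg_right (by nlinarith) (by linarith)
  push_cast at h1
  nlinarith

theorem mul_absHeight_le_evalAt_coeffs {e E r : ℕ} {Q : ℝ} (hE : e + d = E)
    (ε : Fin (r + 1) ≃ Mon N E) {σ : Fin (r + 1) → Fin (N + 1) × Mon N e} {a : L}
    (hdet : (macaulayMinor ε σ (evalAt (primitive f.coeffPoint) a)).det ≠ 0)
    (hr : ((r + 1 : ℕ) : ℝ) ≤ Q) (v : Fin (N + 1) → L) :
    d * absHeight v ≤ Q ^ 2 + Q * ((f.totalHeight + 1) * (1 + absHeight ![a, 1]))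
      + absHeight (formVal (evalAt (primitive f.coeffPoint) a) v) := by
  have h1 := mul_absHeight_le_formVal hE ε σ _ hdet v
  have h2 := absHeight_evalAt_le _ (natDegree_primitive_le f.coeffPoint) a
  have h3 := log_factorial_le (r + 1)
  rw [Nat.factorial_succ, Nat.cast_mul, Real.log_mul (by positivity)
    (by exact_mod_cast (Nat.factorial_pos r).ne')] at h3
  have hT : f.totalHeight = polyHeight (geomHeight f.coeffPoint) (primitive f.coeffPoint)
    + geomHeight f.coeffPoint := rfl
  have hl : Real.log ((geomHeight f.coeffPoint : ℝ) + 1) ≤ geomHeight f.coeffPoint :=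
    (Real.log_le_sub_one_of_pos (by positivity)).trans (by linarith)
  have hη := polyHeight_nonneg (geomHeight f.coeffPoint) (primitive f.coeffPoint)
  have ha := absHeight_nonneg ![a, 1]
  have hg : (0 : ℝ) ≤ geomHeight f.coeffPoint := Nat.cast_nonneg _
  have hr0 : (0 : ℝ) ≤ r := Nat.cast_nonneg _
  have h4 : absHeight (evalAt (primitive f.coeffPoint) a)
      ≤ (f.totalHeight + 1) * (1 + absHeight ![a, 1]) := by
    rw [hT]
    nlinarith [mul_nonneg hη ha]
  have h5 : (r : ℝ) * absHeight (evalAt (primitive f.coeffPoint) a)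
      ≤ Q * ((f.totalHeight + 1) * (1 + absHeight ![a, 1])) :=
    mul_le_mul (by push_cast at hr; linarith) h4 (absHeight_nonneg _)
      ((Nat.cast_nonneg _).trans hr)
  have h6 : ((r + 1 : ℕ) : ℝ) ^ 2 ≤ Q ^ 2 := by gcongr
  push_cast at h3 h6
  linarith

theorem absHeight_le_of_isPreperiodic (hd : 2 ≤ d)
    (P : Projectivization (RatFunc K) (Fin (N + 1) → RatFunc K)) (hP : f.canonicalHeight P ≠ 0)
    (t : Projectivization L (Fin 2 → L))
    (h : IsPreperiodic (f.specialize t) (ProjDyn.specialize P t)) :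
    absHeight t.rep ≤ 72 * (macaulayBound d N : ℝ) ^ 3 *
      max ((ProjDyn.totalHeight P + f.totalHeight + 1) ^ 4 / f.canonicalHeight P ^ 2)
        (f.totalHeight + 1) := by
  have hT := f.one_le_totalHeight_add_one
  set T := f.totalHeight + 1 with hTdef
  set H := ProjDyn.totalHeight P + f.totalHeight + 1 with hHdef
  set Q : ℝ := (macaulayBound d N : ℝ) with hQdef
  by_cases hs : t.rep 1 = 0
  -- The point at infinity has height zero.
  · rw [absHeight_eq_zero_of_apply_one_eq_zero hs]
    exact mul_nonneg (by positivity) (le_max_of_le_right (by linarith))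
  rw [absHeight_rep_eq t hs]
  obtain ⟨m, n, hmn, hm, hper⟩ := f.exists_iterate_eq_of_isPreperiodic P t hs h
  generalize t.rep 0 / t.rep 1 = a at *
  have hcardQ := card_mon_add_le (N := N) (show 1 ≤ d by omega)
  have hQd : (Fintype.card (Mon N d) + d ^ 2 + d + 3 : ℝ) ≤ Q := by
    rw [hQdef]
    exact_mod_cast hcardQ
  have hd' : (2 : ℝ) ≤ d := by exact_mod_cast hd
  have hcard0 : (0 : ℝ) ≤ Fintype.card (Mon N d) := Nat.cast_nonneg _
  have hdQ : (d : ℝ) ^ 2 ≤ Q := by linarith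
  have hQ4 : 4 ≤ Q := by nlinarith
  obtain ⟨e, he⟩ : ∃ e, e + d = macaulayDeg N d := ⟨_, Nat.sub_add_cancel (le_macaulayDeg N d)⟩
  obtain ⟨r, hr⟩ : ∃ r, Fintype.card (Mon N (macaulayDeg N d)) = r + 1 :=
    Nat.exists_eq_succ_of_ne_zero (Fintype.card_pos_iff.2 ⟨purePow N _ 0⟩).ne'
  have hrQ : ((r + 1 : ℕ) : ℝ) ≤ Q := by
    rw [hQdef]
    exact_mod_cast hr ▸ card_mon_le.trans (pow_le_macaulayBound d N)
  let ε := (Fintype.equivFinOfCardEq hr).symm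
  obtain ⟨σ, hσ⟩ := f.exists_det_macaulayMinor_primitive_ne_zero (by omega) he ε
  -- If the determinant vanishes at `a`, the second term of the maximum bounds the height; otherwise
  -- `f_a` is a morphism and the first term does.
  by_cases hS : (macaulayMinor ε σ (evalAt (primitive f.coeffPoint) a)).det = 0
  · refine (f.absHeight_le_of_det_eq_zero ε hσ hrQ (by linarith) hS).trans ?_
    refine mul_le_mul ?_ (le_max_right _ _) (by linarith) (by positivity)
    nlinarith [sq_nonneg Q]
  refine le_trans ?_ (mul_le_mul_of_nonneg_left (le_max_left _ _) (by positivity))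
  have hPh : ProjDyn.totalHeight P = polyHeight (geomHeight P) (primitive P) + geomHeight P := rfl
  have hfh : f.totalHeight = polyHeight (geomHeight f.coeffPoint) (primitive f.coeffPoint)
    + geomHeight f.coeffPoint := rfl
  have hP0 := polyHeight_nonneg (geomHeight P) (primitive P)
  have hf0 := polyHeight_nonneg (geomHeight f.coeffPoint) (primitive f.coeffPoint)
  have hD0 : (0 : ℝ) ≤ geomHeight P := Nat.cast_nonneg _
  have hg0 : (0 : ℝ) ≤ geomHeight f.coeffPoint := Nat.cast_nonneg _
  have hcan := f.abs_geomHeight_sub_le hd (pow_le_macaulayBound d N) P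
  have hgT : 2 * Q * geomHeight f.coeffPoint ≤ 2 * Q * T :=
    mul_le_mul_of_nonneg_left (by linarith) (by linarith)
  refine le_of_forall_pow_bound hd' hdQ hT (by linarith)
    ((f.canonicalHeight_nonneg hd P).lt_of_ne' hP) ?_ (absHeight_nonneg _) fun k hk => ?_
  · have h1 := (abs_le.1 (hcan 0)).1
    simp only [Function.iterate_zero, id_eq, pow_zero, one_mul] at h1
    have h2 : (geomHeight P : ℝ) ≤ 2 * Q * geomHeight P :=
      le_mul_of_one_le_left hD0 (by linarith)
    have h3 : 2 * Q * (geomHeight P + geomHeight f.coeffPoint) ≤ 2 * Q * H :=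
      mul_le_mul_of_nonneg_left (by linarith) (by linarith)
    linarith
  have horb := absHeight_iterate_le_of_preperiodic hd
    (f.mul_absHeight_le_evalAt_coeffs he ε hS hrQ) hmn hper k
  -- The specialized orbit never reaches zero, so the common factor `G` of the `k`-th iterate does
  -- not vanish at `a` and can be dropped from the height.
  have hne : (formVal (evalAt (primitive f.coeffPoint) a))^[k] (evalAt (primitive P) a) ≠ 0 := by
    have hstart : evalAt (primitive P) a ≠ 0 := by
      intro h0
      refine hm ?_
      rw [h0]
      refine Function.iterate_fixed ?_ m
      have := formVal_smul (evalAt (primitive f.coeffPoint) a) (0 : L) 0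
      rwa [zero_pow (by omega), zero_smul, zero_smul] at this
    clear horb hk
    induction k with
    | zero => exact hstart
    | succ k ih =>
      rw [Function.iterate_succ_apply']
      exact formVal_ne_zero he ε hS ih
  obtain ⟨G, hG, hGeq⟩ := f.exists_iterate_formVal_eq P k
  rw [iterate_formVal_evalAt, hGeq] at horb hne
  have hsm : evalAt (G • primitive (f.map^[k] P)) a
      = (G.map (algebraMap K L)).eval a • evalAt (primitive (f.map^[k] P)) a := by
    funext i
    simp [evalAt]
  rw [hsm] at horb hne
  have hGa : (G.map (algebraMap K L)).eval a ≠ 0 := fun h0 => hne (by rw [h0, zero_smul])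
  rw [absHeight_smul _ hGa] at horb
  have hmain := mul_absHeight_le_evalAt (f.map^[k] P) a
  have hpoly := f.polyHeight_primitive_iterate_le hd P k
  have hlow := (abs_le.1 (hcan k)).1
  have hup : (geomHeight (f.map^[k] P) : ℝ) ≤ d ^ k * H := by
    have h1 := (Nat.le_add_right _ _).trans (f.geomHeight_iterate_add_le hd P k)
    have h2 : (geomHeight (f.map^[k] P) : ℝ) ≤ _ := Nat.cast_le.2 h1
    push_cast at h2
    exact h2.trans (mul_le_mul_of_nonneg_left (by linarith) (by positivity))
  have hW : 1 ≤ (d : ℝ) ^ k * H :=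
    one_le_mul_of_one_le_of_one_le (one_le_pow₀ (by linarith)) (by linarith)
  have hpoly' : polyHeight (geomHeight (f.map^[k] P)) (primitive (f.map^[k] P))
      ≤ Q * (d ^ k * H) := by
    refine hpoly.trans ?_
    rw [mul_left_comm]
    exact mul_le_mul_of_nonneg_right hQd (by linarith)
  have hx := absHeight_nonneg ![a, 1]
  have hp0 := polyHeight_nonneg (geomHeight (f.map^[k] P)) (primitive (f.map^[k] P))
  have hDk : (0 : ℝ) ≤ geomHeight (f.map^[k] P) := Nat.cast_nonneg _
  exact mul_le_of_orbit_bound (by linarith) (by linarith) hx hDk hp0 hW hup hpoly' hmain horb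

end ProjEndo

end ProjDyn

theorem corollary2 :
    ∃ C : ℕ → ℕ → ℕ, Computable₂ C ∧
      ∀ (d N : ℕ), 2 ≤ d →
      ∀ (K : Type*) [Field K] [NumberField K]
        (f : ProjDyn.ProjEndo (RatFunc K) N d)
        (P : Projectivization (RatFunc K) (Fin (N + 1) → RatFunc K)),
        f.canonicalHeight P ≠ 0 →
      ∀ (L : Type*) [Field L] [NumberField L] [Algebra K L]
        (t : Projectivization L (Fin 2 → L)),
        ProjDyn.IsPreperiodic (f.specialize t) (ProjDyn.specialize P t) →
        ProjDyn.absHeight t.rep ≤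
          (C d N : ℝ) *
            max ((ProjDyn.totalHeight P + f.totalHeight + 1) ^ 4 / f.canonicalHeight P ^ 2)
              (f.totalHeight + 1) := by
  refine ⟨_, ProjDyn.computable_const_mul_macaulayBound_pow, ?_⟩
  intro d N hd K _ _ f P hP L _ _ _ t h
  have := f.absHeight_le_of_isPreperiodic hd P hP t h
  push_cast
  exact this
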